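/- Let $P=\{P(y|x)\}$ be a discrete memoryless channel with finite alphabets $\mathcal X\neq\emptyset$ and $\mathcal Y$, and let $R>0$, $\rho>0$. For $\varrho\ge 0$ and a probability vector $Q$ on $\mathcal X$ put $$E_0(\varrho,Q)=-\ln\sum_{y}\Big[\sum_{x}Q(x)P(y|x)^{1/(1+\varrho)}\Big]^{1+\varrho},\qquad E_0(\varrho)=\sup_Q E_0(\varrho,Q),$$ $$E_{\rm sp}(R)=\sup_{\varrho\ge 0}\sup_Q\,[E_0(\varrho,Q)-\varrho R]\in[0,\infty].$$ We say that $\varrho\ge0$ achieves $E_{\rm sp}(R)$ if $E_{\rm sp}(R)=E_0(\varrho)-\varrho R$, and that $(\varrho,Q)$ achieves it if $E_{\rm sp}(R)=E_0(\varrho,Q)-\varrho R$. For each $n$ let $Q_n$ be the empirical distribution of some sequence in $\mathcal X^n$ and let $\mathcal T(Q_n)$ be its type class. Let $X_0,\dots,X_{M-1}$, with $M-1=\lfloor e^{nR}\rfloor$, be independent and uniform on $\mathcal T(Q_n)$, and let $Y$ be the channel output when $X_0$ is sent. Let $N$ be the number of $m\in\{1,\dots,M-1\}$ such that the score of $X_m$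 given $Y$ is at least that of $X_0$, where the score is either the empirical mutual information $\hat I_{xy}(X;Y)$ or the likelihood $P(y|x)$. Then the following hold. 1. For every choice of the types $Q_n$ and for both scores, $$\liminf_{n\to\infty}\frac1n\ln \mathbf E\{N^\rho\}\ \ge\ S:=\sup_{0<\lambda<R}\,[\rho\lambda-E_{\rm sp}(R-\lambda)].$$ 2. Suppose that $E_{\rm sp}(r)<\infty$ for some $r<R$. Then some $\varrho(R)\ge 0$ achieves $E_{\rm sp}(R)$, and for each such $\varrho(R)$: if $\rho\le\varrho(R)$, then $S=-E_{\rm sp}(R)$; if $\rho>\varrho(R)$ and $\rho$ achieves $E_{\rm sp}(R')$ for some rate $R'$ (that is, $\varrho^{-1}(\rho)$ exists, as is always the case when $E_0(\cdot)$ is concave), then $S=\rho R-E_0(\rho)$. 3. For both scores: if $\varrho(R)$ achieves $E_{\rm sp}(R)$ and $\rho\le\varrho(R)$, then $\liminf_{n}\frac1n\ln\mathbf E\{N^\rho\}\ge -E_{\rm sp}(R)$ for every choice of the types $Q_n$; and if $(\varrho(R),Q)$ achieves $E_{\rm sp}(R)$, $\rho>\varrho(R)$ and $Q_n\to Q$,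 then $\liminf_{n}\frac1n\ln\mathbf E\{N^\rho\}\ge\rho R-E_0(\rho)$. -/

import Mathlib

open Filter Topology Finset

noncomputable section

namespace ListDecoding

variable {X Y : Type*} [Fintype X] [Fintype Y]

/-- Gallager's function
`E₀(ρ, Q) = - ln ∑_y [∑_x Q(x) P(y|x)^{1/(1+ρ)}]^{1+ρ}`, where `P x y` stands for `P(y|x)`. -/
def gallagerE0Q (P : X → Y → ℝ) (ρ : ℝ) (Q : X → ℝ) : ℝ :=
  -Real.log (∑ y, (∑ x, Q x * P x y ^ (1 / (1 + ρ))) ^ (1 + ρ))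

/-- `E₀(ρ) = sup_Q E₀(ρ, Q)`, over all probability vectors `Q` on the input alphabet. -/
def gallagerE0 (P : X → Y → ℝ) (ρ : ℝ) : ℝ :=
  ⨆ Q : stdSimplex ℝ X, gallagerE0Q P ρ (Q : X → ℝ)

/-- The sphere-packing exponent `E_sp(R) = sup_{ρ ≥ 0} sup_Q [E₀(ρ, Q) - ρ R]`, which may be
infinite at low rates. -/
def spherePacking (P : X → Y → ℝ) (R : ℝ) : EReal :=
  ⨆ ρ : {ρ : ℝ // 0 ≤ ρ}, ⨆ Q : stdSimplex ℝ X,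
    ((gallagerE0Q P (ρ : ℝ) (Q : X → ℝ) - (ρ : ℝ) * R : ℝ) : EReal)

/-- `r` achieves the supremum over `ρ ≥ 0` in the definition of `E_sp(R)`. -/
def IsAchiever (P : X → Y → ℝ) (R r : ℝ) : Prop :=
  0 ≤ r ∧ ((gallagerE0 P r - r * R : ℝ) : EReal) = spherePacking P R

/-- `(r, Q)` achieves the double supremum in the definition of `E_sp(R)`. -/
def IsAchieverPair (P : X → Y → ℝ) (R r : ℝ) (Q : X → ℝ) : Prop :=
  0 ≤ r ∧ Q ∈ stdSimplex ℝ X ∧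
    ((gallagerE0Q P r Q - r * R : ℝ) : EReal) = spherePacking P R

/-- `sup_{0 < lam < R} [ρ lam - E_sp(R - lam)]`, an extended real number. -/
def momentBound (P : X → Y → ℝ) (R ρ : ℝ) : EReal :=
  ⨆ lam : Set.Ioo (0 : ℝ) R,
    ((ρ * (lam : ℝ) : ℝ) : EReal) - spherePacking P (R - (lam : ℝ))

variable [DecidableEq X] [DecidableEq Y]

/-- The set of all sequences of length `n` with `c a` occurrences of each symbol `a`: the type
class of the empirical distribution `a ↦ c a / n` (when `∑ a, c a = n`). -/
def typeClass (n : ℕ) (c : X → ℕ) : Finset (Fin n → X) :=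
  univ.filter fun x => ∀ a, (univ.filter fun i => x i = a).card = c a

/-- The empirical distribution of a sequence (also used for the sequence of pairs). -/
def empirical {A : Type*} [DecidableEq A] {n : ℕ} (x : Fin n → A) (a : A) : ℝ :=
  ((univ.filter fun i => x i = a).card : ℝ) / n

/-- The empirical mutual information of `x` and `y`, in nats. -/
def empiricalMI {n : ℕ} (x : Fin n → X) (y : Fin n → Y) : ℝ :=
  ∑ a, ∑ b, empirical (fun i => (x i, y i)) (a, b) *
    Real.log (empirical (fun i => (x i, y i)) (a, b) / (empirical x a * empirical y b))

/-- The likelihood `P(y|x) = ∏ᵢ P(yᵢ|xᵢ)` of the memoryless channel. -/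
def likelihood (P : X → Y → ℝ) {n : ℕ} (x : Fin n → X) (y : Fin n → Y) : ℝ :=
  ∏ i, P (x i) (y i)

/-- A decoding metric, for every block length. -/
abbrev Score (X Y : Type*) := ∀ n : ℕ, (Fin n → X) → (Fin n → Y) → ℝ

/-- The score of the maximum mutual information decoder. -/
def mmiScore : Score X Y := fun _ x y => empiricalMI x y

/-- The score of the maximum likelihood decoder. -/
def mlScore (P : X → Y → ℝ) : Score X Y := fun _ x y => likelihood P x y

/-- The number `N` of incorrect codewords (those with index `m ≠ 0`) whose score is at least
that of the correct codeword, which has index `0`. -/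
def numCompetitors (s : Score X Y) {n K : ℕ} (C : Fin (K + 1) → Fin n → X) (y : Fin n → Y) : ℕ :=
  (univ.filter fun m : Fin (K + 1) => m ≠ 0 ∧ s n (C 0) y ≤ s n (C m) y).card

/-- `E{N^ρ}`, where the `K + 1` codewords are independent and uniform on the type class of `c`,
and the channel output `y` is the response of the memoryless channel `P` to codeword `0`. -/
def moment (P : X → Y → ℝ) (s : Score X Y) (n K : ℕ) (c : X → ℕ) (ρ : ℝ) : ℝ :=
  ∑ C ∈ Fintype.piFinset (fun _ : Fin (K + 1) => typeClass n c),
    ∑ y : Fin n → Y, (((typeClass n c).card : ℝ)⁻¹) ^ (K + 1) * likelihood P (C 0) y *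
      (numCompetitors s C y : ℝ) ^ ρ

/-- `liminf_n (1/n) ln E{N^ρ}` for codes with `⌊e^{nR}⌋` incorrect codewords, the type class at
block length `n` being that of `c n`.  It is an extended real number; the argument of the
logarithm is positive whenever `c n` is a type and `R ≥ 0`, because all codewords may coincide. -/
def momentExponent (P : X → Y → ℝ) (s : Score X Y) (c : ℕ → X → ℕ) (R ρ : ℝ) : EReal :=
  liminf (fun n : ℕ =>
    ((Real.log (moment P s n ⌊Real.exp (n * R)⌋₊ (c n) ρ) / n : ℝ) : EReal)) atTop

end ListDecoding

end

/-! The moment is bounded below by keeping one joint type `k` at a time. Suppose `X_0` and `Y` have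
joint type `k`. Every competitor with the same joint type with `Y` ties with `X_0`, since both
scores depend only on the joint type (`score_eq`). So `N` is at least the number of hits of i.i.d.
codewords in a shell of relative size `p`, with mean `μ = Kp` and `K = ⌊e^{nR}⌋`. A second-moment
argument (`sum_rpow_hits_ge`) shows that this contributes about `min(1, μ) · max(1, μ)^ρ`.
Stirling-type bounds turn it into the exponent `-D + min(0, R - I) + ρ max(0, R - I)`, where `D` and
`I` are the divergence from the channel and the mutual information of the joint type
(`log_moment_ge`). Rounding and uniform continuity extend this to all joint distributions whose
input marginal is the given type (`le_momentExponent`).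

It remains to find good joint distributions for every input type. For each `r ≥ 0` there is one test
channel with `D + r I ≤ E₀(r)` for all inputs simultaneously (`exists_testChannel`). It is the
tilted channel at a maximizing input, and the optimality conditions there make it work for other
inputs too. Separating convex sets in the `(D, I)` plane converts this family of linear bounds into
one joint distribution with `D ≤ E_sp(R - λ) + ε` and `I ≤ R - λ + ε`
(`exists_joint_of_spherePacking_le`). Inserting it in the exponent gives `ρλ - E_sp(R - λ)`.

The supremum over `λ` is evaluated by convex analysis: `E_sp` is a supremum of decreasing affine
functions of the rate, and an achiever supplies a supporting line.

For `Q_n → Q` and `ρ > ϱ(R)`, the test channel for `ρ` is used directly. If its information at `Q`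
is at most `R`, it yields `ρR - E₀(ρ)`; otherwise achievement by `(ϱ(R), Q)` forces `-E_sp(R)` to be
larger still (`sub_gallagerE0_le_momentExponent`). -/

noncomputable section

namespace ListDecoding

/-! ### Type classes as orbits of position permutations. -/

section TypeClass

variable {A : Type*} [Fintype A] [DecidableEq A]

lemma mem_typeClass {n : ℕ} {c : A → ℕ} {x : Fin n → A} :
    x ∈ typeClass n c ↔ ∀ a, (univ.filter fun i => x i = a).card = c a := by
  simp [typeClass]

lemma typeClass_nonempty {n : ℕ} {c : A → ℕ} (hc : ∑ a, c a = n) : (typeClass n c).Nonempty := by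
  have e : Fin n ≃ Σ a, Fin (c a) := Fintype.equivOfCardEq (by simp [hc])
  refine ⟨fun i => (e i).1, mem_typeClass.2 fun a => ?_⟩
  have h : (univ.filter fun i => (e i).1 = a).card
      = (univ.filter fun p : Σ a, Fin (c a) => p.1 = a).card := by
    refine Finset.card_equiv e fun i => ?_
    simp
  rw [h]
  have : (univ.filter fun p : Σ a, Fin (c a) => p.1 = a)
      = (univ : Finset (Fin (c a))).map ⟨Sigma.mk a, sigma_mk_injective⟩ := by
    ext ⟨b, j⟩
    simp only [mem_filter, mem_univ, true_and, Finset.mem_map]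
    constructor
    · rintro rfl; exact ⟨j, rfl⟩
    · rintro ⟨j', h⟩; exact (congrArg Sigma.fst h).symm
  rw [this]; simp

lemma comp_mem_typeClass {n : ℕ} {c : A → ℕ} {x : Fin n → A} (σ : Equiv.Perm (Fin n)) :
    x ∘ σ ∈ typeClass n c ↔ x ∈ typeClass n c := by
  simp only [mem_typeClass]
  refine forall_congr' fun a => ?_
  rw [Finset.card_equiv (t := univ.filter fun i => x i = a) σ]
  intro i; simp

lemma exists_perm_of_mem_typeClass {n : ℕ} {c : A → ℕ} {x x' : Fin n → A}
    (hx : x ∈ typeClass n c) (hx' : x' ∈ typeClass n c) :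
    ∃ σ : Equiv.Perm (Fin n), x ∘ σ = x' := by
  rw [mem_typeClass] at hx hx'
  have h : ∀ a, Nonempty ({i // x' i = a} ≃ {i // x i = a}) := fun a =>
    ⟨Fintype.equivOfCardEq (by rw [Fintype.card_subtype, Fintype.card_subtype, hx, hx'])⟩
  refine ⟨(Equiv.sigmaFiberEquiv x').symm.trans
    ((Equiv.sigmaCongrRight fun a => (h a).some).trans (Equiv.sigmaFiberEquiv x)), ?_⟩
  funext i
  exact ((h (x' i)).some ⟨i, rfl⟩).2

/-- The cardinality of a type class is a multinomial coefficient. -/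
lemma card_typeClass_mul {n : ℕ} {c : A → ℕ} (hc : ∑ a, c a = n) :
    (typeClass n c).card * ∏ a, (c a).factorial = n.factorial := by
  obtain ⟨x₀, hx₀⟩ := typeClass_nonempty hc
  -- The map `σ ↦ x₀ ∘ σ` sends permutations onto the type class, and each fibre is a translate of
  -- the stabilizer of `x₀`, whose order is `∏ (c a)!`.
  have h := Finset.card_eq_sum_card_fiberwise (s := (univ : Finset (Equiv.Perm (Fin n))))
    (t := typeClass n c) (f := fun σ : Equiv.Perm (Fin n) => x₀ ∘ σ) (fun σ _ => by
      simpa using (comp_mem_typeClass σ).2 hx₀)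
  rw [Finset.card_univ, Fintype.card_perm, Fintype.card_fin] at h
  rw [h, ← smul_eq_mul, ← Finset.sum_const]
  refine Finset.sum_congr rfl fun x hx => ?_
  obtain ⟨τ, rfl⟩ := exists_perm_of_mem_typeClass hx₀ hx
  have h1 := DomMulAct.stabilizer_card x₀
  have h2 : ∀ a, Fintype.card {i // x₀ i = a} = c a := fun a => by
    rw [Fintype.card_subtype]; exact mem_typeClass.1 hx₀ a
  simp only [h2] at h1
  rw [← h1, Fintype.card_subtype]
  refine Finset.card_equiv (Equiv.mulRight τ) fun σ => ?_
  simp only [mem_filter, mem_univ, true_and, Equiv.coe_mulRight, Equiv.Perm.coe_mul]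
  constructor
  · intro h; rw [← Function.comp_assoc, h]
  · intro h
    have := congrArg (· ∘ τ.symm) h
    simpa [Function.comp_assoc] using this

end TypeClass

/-! ### Joint types and conditional shells. -/

section JointType

variable {X Y : Type*} [Fintype X] [Fintype Y] [DecidableEq X] [DecidableEq Y]

/-- The pairs of sequences whose joint occurrence counts are `k`. -/
def jointClass (n : ℕ) (k : X × Y → ℕ) : Finset ((Fin n → X) × (Fin n → Y)) :=
  univ.filter fun p => (fun i => (p.1 i, p.2 i)) ∈ typeClass n k

/-- The sequences of the given joint type with `y`. -/
def shell (n : ℕ) (k : X × Y → ℕ) (y : Fin n → Y) : Finset (Fin n → X) :=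
  univ.filter fun x => (fun i => (x i, y i)) ∈ typeClass n k

lemma card_jointClass (n : ℕ) (k : X × Y → ℕ) :
    (jointClass n k).card = (typeClass n k).card := by
  refine Finset.card_equiv (Equiv.arrowProdEquivProdArrow (Fin n) (fun _ => X) (fun _ => Y)).symm fun p => ?_
  simp [jointClass, Equiv.arrowProdEquivProdArrow]

lemma fst_mem_typeClass {n : ℕ} {k : X × Y → ℕ} {x : Fin n → X} {y : Fin n → Y}
    (h : (fun i => (x i, y i)) ∈ typeClass n k) : x ∈ typeClass n fun a => ∑ b, k (a, b) := by
  rw [mem_typeClass] at h ⊢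
  intro a
  rw [Finset.card_eq_sum_card_fiberwise (f := y) (t := univ) (by simp)]
  refine Finset.sum_congr rfl fun b _ => ?_
  rw [← h (a, b), Finset.filter_filter]
  simp [Prod.ext_iff]

lemma snd_mem_typeClass {n : ℕ} {k : X × Y → ℕ} {x : Fin n → X} {y : Fin n → Y}
    (h : (fun i => (x i, y i)) ∈ typeClass n k) : y ∈ typeClass n fun b => ∑ a, k (a, b) := by
  rw [mem_typeClass] at h ⊢
  intro b
  rw [Finset.card_eq_sum_card_fiberwise (f := x) (t := univ) (by simp)]
  refine Finset.sum_congr rfl fun a _ => ?_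
  rw [← h (a, b), Finset.filter_filter]
  simp [Prod.ext_iff, and_comm]

lemma shell_subset (n : ℕ) (k : X × Y → ℕ) (y : Fin n → Y) :
    shell n k y ⊆ typeClass n fun a => ∑ b, k (a, b) := fun x hx =>
  fst_mem_typeClass (by simpa [shell] using hx)

lemma card_shell_comp (n : ℕ) (k : X × Y → ℕ) (y : Fin n → Y) (σ : Equiv.Perm (Fin n)) :
    (shell n k (y ∘ σ)).card = (shell n k y).card := by
  symm
  refine Finset.card_equiv (Equiv.arrowCongr σ.symm (Equiv.refl X)) fun x => ?_
  simp only [shell, mem_filter, mem_univ, true_and]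
  rw [← comp_mem_typeClass σ]
  rfl

lemma sum_card_shell (n : ℕ) (k : X × Y → ℕ) :
    ∑ y, (shell n k y).card = (typeClass n k).card := by
  rw [← card_jointClass, Finset.card_eq_sum_card_fiberwise (f := Prod.snd) (t := univ) (by simp)]
  refine Finset.sum_congr rfl fun y _ => ?_
  refine Finset.card_bij (fun x _ => (x, y)) ?_ ?_ ?_
  · intro x hx; simpa [shell, jointClass] using hx
  · intro x _ x' _ h; exact (Prod.ext_iff.1 h).1
  · rintro ⟨x, y'⟩ h
    simp only [jointClass, mem_filter, mem_univ, true_and] at h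
    obtain ⟨h, rfl⟩ := h
    exact ⟨x, by simpa [shell] using h, rfl⟩

/-- All shells around the sequences of the output type have the same size. -/
lemma card_shell_mul {n : ℕ} {k : X × Y → ℕ} {y : Fin n → Y}
    (hy : y ∈ typeClass n fun b => ∑ a, k (a, b)) :
    (shell n k y).card * (typeClass n fun b => ∑ a, k (a, b)).card = (typeClass n k).card := by
  rw [← sum_card_shell n k, mul_comm, ← smul_eq_mul, ← Finset.sum_const]
  rw [← Finset.sum_subset (Finset.subset_univ (typeClass n fun b => ∑ a, k (a, b)))]
  · refine Finset.sum_congr rfl fun y' hy' => ?_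
    obtain ⟨σ, rfl⟩ := exists_perm_of_mem_typeClass hy hy'
    exact (card_shell_comp n k y σ).symm
  · intro y' _ hy'
    rw [Finset.card_eq_zero, Finset.eq_empty_iff_forall_notMem]
    intro x hx
    exact hy' (snd_mem_typeClass (by simpa [shell] using hx))

lemma likelihood_eq_prod {P : X → Y → ℝ} {n : ℕ} {k : X × Y → ℕ} {x : Fin n → X} {y : Fin n → Y}
    (h : (fun i => (x i, y i)) ∈ typeClass n k) :
    likelihood P x y = ∏ p : X × Y, P p.1 p.2 ^ k p := by
  rw [mem_typeClass] at h
  unfold likelihood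
  rw [← Finset.prod_fiberwise_of_maps_to (s := univ) (t := univ) (g := fun i => (x i, y i)) (by simp)]
  refine Finset.prod_congr rfl fun p _ => ?_
  rw [Finset.prod_congr rfl (g := fun _ => P p.1 p.2), Finset.prod_const, h]
  intro i hi
  simp only [mem_filter, mem_univ, true_and] at hi
  rw [← hi]

lemma empirical_eq {A : Type*} [Fintype A] [DecidableEq A] {n : ℕ} {c : A → ℕ} {x : Fin n → A}
    (h : x ∈ typeClass n c) (a : A) : empirical x a = c a / n := by
  rw [mem_typeClass] at h
  rw [empirical, h]

/-- Both scores are functions of the joint counts alone. This is the only property of the scores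
that the moment bound needs. -/
lemma score_eq {P : X → Y → ℝ} {s : Score X Y} (hs : s = mmiScore ∨ s = mlScore P)
    {n : ℕ} {k : X × Y → ℕ} {x x' : Fin n → X} {y : Fin n → Y}
    (h : (fun i => (x i, y i)) ∈ typeClass n k) (h' : (fun i => (x' i, y i)) ∈ typeClass n k) :
    s n x y = s n x' y := by
  rcases hs with rfl | rfl
  · simp only [mmiScore, empiricalMI, empirical_eq h, empirical_eq h',
      empirical_eq (fst_mem_typeClass h), empirical_eq (fst_mem_typeClass h')]
  · simp only [mlScore, likelihood_eq_prod h, likelihood_eq_prod h']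

end JointType

/-! ### Second-moment bound for the number of hits. -/

section SecondMoment

variable {A : Type*} [DecidableEq A]

/-- Independence in counting form: each constrained codeword costs a factor `|S| / |T|`. -/
lemma card_filter_piFinset {K : ℕ} {S T : Finset A} (hST : S ⊆ T) (hT : T.Nonempty)
    (J : Finset (Fin K)) :
    (((Fintype.piFinset fun _ : Fin K => T).filter fun C => ∀ m ∈ J, C m ∈ S).card : ℝ)
      = (T.card : ℝ) ^ K * ((S.card : ℝ) / T.card) ^ J.card := by
  have h : (Fintype.piFinset fun _ : Fin K => T).filter (fun C => ∀ m ∈ J, C m ∈ S)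
      = Fintype.piFinset fun m => if m ∈ J then S else T := by
    ext C
    simp only [mem_filter, Fintype.mem_piFinset]
    constructor
    · rintro ⟨h1, h2⟩ m
      split_ifs with hm
      · exact h2 m hm
      · exact h1 m
    · intro h
      refine ⟨fun m => ?_, fun m hm => ?_⟩
      · have := h m
        split_ifs at this
        · exact hST this
        · exact this
      · simpa [hm] using h m
  have hT' : (T.card : ℝ) ≠ 0 := by exact_mod_cast hT.card_pos.ne'
  have h3 : ∀ m, ((if m ∈ J then S else T).card : ℝ)
      = (T.card : ℝ) * if m ∈ J then (S.card : ℝ) / T.card else 1 := by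
    intro m; split_ifs <;> field_simp
  rw [h, Fintype.card_piFinset, Nat.cast_prod]
  simp_rw [h3]
  rw [Finset.prod_mul_distrib, Finset.prod_const, Finset.prod_ite_mem]
  simp [div_pow]

/-- A Paley–Zygmund type lower bound on the moments of a nonnegative integer. -/
lemma rpow_ge_quadratic {N : ℕ} {μ t ρ : ℝ} (hμ : 0 < μ) (ht : 0 < t) (hρ : 0 < ρ) :
    (max 1 (μ / 2)) ^ ρ * (2 * t * (N - μ / 2) - t ^ 2 * (N : ℝ) ^ 2) ≤ (N : ℝ) ^ ρ := by
  have hM : 0 ≤ (max 1 (μ / 2)) ^ ρ := by positivity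
  by_cases h : (N : ℝ) ≤ μ / 2
  · have h1 : 2 * t * (N - μ / 2) - t ^ 2 * (N : ℝ) ^ 2 ≤ 0 := by
      have : 2 * t * (N - μ / 2) ≤ 0 := mul_nonpos_of_nonneg_of_nonpos (by positivity) (by linarith)
      have : 0 ≤ t ^ 2 * (N : ℝ) ^ 2 := by positivity
      linarith
    exact (mul_nonpos_of_nonneg_of_nonpos hM h1).trans (by positivity)
  · push Not at h
    have hN : 0 < N := by
      have : (0 : ℝ) < N := by linarith
      exact_mod_cast this
    have hN1 : (1 : ℝ) ≤ N := by exact_mod_cast hN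
    -- Since `2tN - t²N² ≤ 1`, the quadratic is a minorant of the indicator of `N > μ/2`, and its
    -- mean involves only two moments of `N`.
    have h1 : 2 * t * (N - μ / 2) - t ^ 2 * (N : ℝ) ^ 2 ≤ 1 := by
      nlinarith [sq_nonneg (t * N - 1), mul_pos ht hμ]
    calc _ ≤ (max 1 (μ / 2)) ^ ρ * 1 := mul_le_mul_of_nonneg_left h1 hM
      _ = (max 1 (μ / 2)) ^ ρ := mul_one _
      _ ≤ _ := Real.rpow_le_rpow (by positivity) (max_le hN1 h.le) hρ.le

/-- Given `C 0 ∈ S`, the number of hits has mean `μ` and second moment at most `μ² + μ`, so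
averaging the quadratic minorant gives the claim. Probabilities are kept as counts, whence the
factor `|T|^(K+1)`. -/
lemma sum_rpow_hits_ge {K : ℕ} {S T : Finset A} (hST : S ⊆ T) (hS : S.Nonempty) (hK : 0 < K)
    {ρ : ℝ} (hρ : 0 < ρ) {p μ : ℝ} (hp : p = (S.card : ℝ) / T.card) (hμ : μ = K * p) :
    (T.card : ℝ) ^ (K + 1) * (p * (μ / (4 * (1 + μ)) * (max 1 (μ / 2)) ^ ρ)) ≤
      ∑ C ∈ (Fintype.piFinset fun _ : Fin (K + 1) => T).filter fun C => C 0 ∈ S,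
        (((univ.filter fun m : Fin (K + 1) => m ≠ 0 ∧ C m ∈ S).card : ℕ) : ℝ) ^ ρ := by
  have hT : T.Nonempty := hS.mono hST
  have hT' : (0 : ℝ) < T.card := by exact_mod_cast hT.card_pos
  have hS' : (0 : ℝ) < S.card := by exact_mod_cast hS.card_pos
  have hp0 : 0 < p := by rw [hp]; positivity
  have hK' : (0 : ℝ) < K := by exact_mod_cast hK
  have hμ0 : 0 < μ := by rw [hμ]; positivity
  set Ω := (Fintype.piFinset fun _ : Fin (K + 1) => T).filter fun C => C 0 ∈ S with hΩ
  set N : (Fin (K + 1) → A) → ℕ := fun C => (univ.filter fun m : Fin (K + 1) => m ≠ 0 ∧ C m ∈ S).card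
  set I : Finset (Fin (K + 1)) := univ.filter fun m => m ≠ 0 with hI
  have hIcard : (I.card : ℝ) = K := by
    rw [hI, Finset.filter_ne' univ (0 : Fin (K + 1)), Finset.card_erase_of_mem (mem_univ _)]; simp
  have hN : ∀ C, (N C : ℝ) = ∑ m ∈ I, if C m ∈ S then (1 : ℝ) else 0 := by
    intro C
    simp only [N]
    rw [← Finset.filter_filter, Finset.card_filter]
    push_cast; rfl
  -- Index `0` is inserted because membership in `Ω` already forces `C 0 ∈ S`.
  have hcard : ∀ J : Finset (Fin (K + 1)),
      (∑ C ∈ Ω, if ∀ m ∈ J, C m ∈ S then (1 : ℝ) else 0)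
        = (T.card : ℝ) ^ (K + 1) * p ^ (insert 0 J).card := by
    intro J
    rw [Finset.sum_boole, hΩ, Finset.filter_filter, hp, ← card_filter_piFinset hST hT]
    congr 3
    ext C; simp
  have h0 : ∑ C ∈ Ω, (1 : ℝ) = (T.card : ℝ) ^ (K + 1) * p := by
    have := hcard ∅
    simpa using this
  have h1 : ∑ C ∈ Ω, (N C : ℝ) = (T.card : ℝ) ^ (K + 1) * (p * μ) := by
    simp_rw [hN]
    rw [Finset.sum_comm]
    have : ∀ m ∈ I, (∑ C ∈ Ω, if C m ∈ S then (1 : ℝ) else 0) = (T.card : ℝ) ^ (K + 1) * p ^ 2 := by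
      intro m hm
      have hm0 : m ≠ 0 := by simpa [hI] using hm
      have := hcard {m}
      rw [Finset.card_pair hm0.symm] at this
      simpa using this
    rw [Finset.sum_congr rfl this, Finset.sum_const, nsmul_eq_mul, hIcard, hμ]; ring
  have h2 : ∑ C ∈ Ω, (N C : ℝ) ^ 2 ≤ (T.card : ℝ) ^ (K + 1) * (p * (μ ^ 2 + μ)) := by
    have e : ∀ C, (N C : ℝ) ^ 2 = ∑ m ∈ I, ∑ m' ∈ I, if ∀ j ∈ ({m, m'} : Finset (Fin (K + 1))), C j ∈ S
        then (1 : ℝ) else 0 := by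
      intro C
      rw [hN, sq, Finset.sum_mul_sum]
      refine Finset.sum_congr rfl fun m _ => Finset.sum_congr rfl fun m' _ => ?_
      by_cases h : C m ∈ S <;> by_cases h' : C m' ∈ S <;> simp [h, h']
    simp_rw [e]
    rw [Finset.sum_comm]
    have : ∀ m ∈ I, (∑ C ∈ Ω, ∑ m' ∈ I, if ∀ j ∈ ({m, m'} : Finset (Fin (K + 1))), C j ∈ S
        then (1 : ℝ) else 0) ≤ (T.card : ℝ) ^ (K + 1) * (K * p ^ 3 + p ^ 2) := by
      intro m hm
      have hm0 : m ≠ 0 := by simpa [hI] using hm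
      rw [Finset.sum_comm]
      have : ∀ m' ∈ I, (∑ C ∈ Ω, if ∀ j ∈ ({m, m'} : Finset (Fin (K + 1))), C j ∈ S
          then (1 : ℝ) else 0) ≤ (T.card : ℝ) ^ (K + 1) * (p ^ 3 + if m = m' then p ^ 2 else 0) := by
        intro m' hm'
        have hm0' : m' ≠ 0 := by simpa [hI] using hm'
        rw [hcard]
        refine mul_le_mul_of_nonneg_left ?_ (by positivity)
        split_ifs with h
        · subst h
          rw [Finset.pair_eq_singleton, Finset.card_pair hm0.symm]
          have : 0 ≤ p ^ 3 := by positivity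
          linarith
        · rw [Finset.card_insert_of_notMem (by simp [hm0.symm, hm0'.symm]), Finset.card_pair h]
          simp
      refine (Finset.sum_le_sum this).trans ?_
      rw [← Finset.mul_sum, Finset.sum_add_distrib, Finset.sum_const, nsmul_eq_mul, hIcard,
        Finset.sum_ite_eq, if_pos hm]
    refine (Finset.sum_le_sum this).trans (le_of_eq ?_)
    rw [Finset.sum_const, nsmul_eq_mul, hIcard, hμ]; ring
  have hM : 0 ≤ (max 1 (μ / 2)) ^ ρ := by positivity
  -- This `t` maximizes the resulting bound `tμ - t²(μ + μ²)`, with value `μ / (4(1 + μ))`.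
  set t : ℝ := 1 / (2 * (1 + μ)) with ht
  have ht0 : 0 < t := by positivity
  have key : ∑ C ∈ Ω, (max 1 (μ / 2)) ^ ρ * (2 * t * (N C - μ / 2) - t ^ 2 * (N C : ℝ) ^ 2)
      ≤ ∑ C ∈ Ω, (N C : ℝ) ^ ρ := Finset.sum_le_sum fun C _ => rpow_ge_quadratic hμ0 ht0 hρ
  refine le_trans ?_ key
  rw [← Finset.mul_sum]
  have e : ∑ C ∈ Ω, (2 * t * (N C - μ / 2) - t ^ 2 * (N C : ℝ) ^ 2)
      = 2 * t * ∑ C ∈ Ω, (N C : ℝ) - t * μ * ∑ C ∈ Ω, (1 : ℝ) - t ^ 2 * ∑ C ∈ Ω, (N C : ℝ) ^ 2 := by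
    simp only [Finset.mul_sum, ← Finset.sum_sub_distrib]
    exact Finset.sum_congr rfl fun C _ => by ring
  rw [e, h1, h0]
  set W := (T.card : ℝ) ^ (K + 1)
  have hW : 0 < W := by positivity
  have e2 : W * (p * (μ / (4 * (1 + μ)))) =
      2 * t * (W * (p * μ)) - t * μ * (W * p) - t ^ 2 * (W * (p * (μ ^ 2 + μ))) := by
    rw [ht]; field_simp; ring
  have : W * (p * (μ / (4 * (1 + μ)))) ≤
      2 * t * (W * (p * μ)) - t * μ * (W * p) - t ^ 2 * ∑ C ∈ Ω, (N C : ℝ) ^ 2 := by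
    rw [e2]; gcongr
  calc _ = (max 1 (μ / 2)) ^ ρ * (W * (p * (μ / (4 * (1 + μ))))) := by ring
    _ ≤ _ := mul_le_mul_of_nonneg_left this hM

end SecondMoment

/-! ### From hits in a shell to the moment. -/

section Moment

variable {X Y : Type*} [Fintype X] [Fintype Y] [DecidableEq X] [DecidableEq Y]

/-- The contribution of a single joint type to the moment of the number of competitors. -/
lemma moment_ge {P : X → Y → ℝ} (hP : ∀ x y, 0 ≤ P x y) {s : Score X Y}
    (hs : s = mmiScore ∨ s = mlScore P) {n K : ℕ} (hK : 0 < K) {ρ : ℝ} (hρ : 0 < ρ)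
    {k : X × Y → ℕ} (hk : ∑ p, k p = n) {c : X → ℕ} (hc : ∀ a, ∑ b, k (a, b) = c a)
    {d : Y → ℕ} (hd : ∀ b, ∑ a, k (a, b) = d b) {μ : ℝ}
    (hμ : μ = K * ((typeClass n k).card / ((typeClass n c).card * (typeClass n d).card))) :
    (∏ p : X × Y, P p.1 p.2 ^ k p) * ((typeClass n k).card / (typeClass n c).card) *
      (μ / (4 * (1 + μ)) * (max 1 (μ / 2)) ^ ρ) ≤ moment P s n K c ρ := by
  obtain rfl : c = fun a => ∑ b, k (a, b) := funext fun a => (hc a).symm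
  obtain rfl : d = fun b => ∑ a, k (a, b) := funext fun b => (hd b).symm
  set T := typeClass n fun a => ∑ b, k (a, b) with hT
  set U := typeClass n fun b => ∑ a, k (a, b) with hU
  have hTn : T.Nonempty := typeClass_nonempty (by rw [← hk, Fintype.sum_prod_type])
  have hUn : U.Nonempty := typeClass_nonempty (by rw [← hk, Fintype.sum_prod_type_right])
  have hkn : (typeClass n k).Nonempty := typeClass_nonempty hk
  have hT0 : (0 : ℝ) < T.card := by exact_mod_cast hTn.card_pos
  have hU0 : (0 : ℝ) < U.card := by exact_mod_cast hUn.card_pos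
  have hk0 : (0 : ℝ) < (typeClass n k).card := by exact_mod_cast hkn.card_pos
  set ℓ := ∏ p : X × Y, P p.1 p.2 ^ k p with hℓ
  have hℓ0 : 0 ≤ ℓ := Finset.prod_nonneg fun p _ => pow_nonneg (hP _ _) _
  have hlik : ∀ (x : Fin n → X) (y : Fin n → Y), 0 ≤ likelihood P x y := fun x y =>
    Finset.prod_nonneg fun i _ => hP _ _
  -- For a fixed output of the right type, only codebooks with `C 0` in the shell of `y` are kept.
  -- The hit probability `|k| / (|T| |U|)` is the same for all such `y`, so summing over `U` merely
  -- multiplies by `|U|`.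
  have hterm : ∀ y ∈ U, (T.card : ℝ)⁻¹ ^ (K + 1) * ℓ * ((T.card : ℝ) ^ (K + 1) *
      ((typeClass n k).card / (T.card * U.card) * (μ / (4 * (1 + μ)) * (max 1 (μ / 2)) ^ ρ))) ≤
      ∑ C ∈ Fintype.piFinset (fun _ : Fin (K + 1) => T),
        (T.card : ℝ)⁻¹ ^ (K + 1) * likelihood P (C 0) y * (numCompetitors s C y : ℝ) ^ ρ := by
    intro y hy
    have hcard : ((shell n k y).card : ℝ) * U.card = (typeClass n k).card := by
      exact_mod_cast card_shell_mul hy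
    have hSn : (shell n k y).Nonempty := by
      rw [← Finset.card_pos, Nat.pos_iff_ne_zero]
      intro h
      rw [h] at hcard
      exact hk0.ne' (by rw [← hcard]; simp)
    have hp : (typeClass n k).card / (T.card * U.card : ℝ) = (shell n k y).card / (T.card : ℝ) := by
      rw [← hcard]; field_simp
    have h := sum_rpow_hits_ge (shell_subset n k y) hSn hK hρ hp hμ
    refine (mul_le_mul_of_nonneg_left h (by positivity)).trans ?_
    rw [Finset.mul_sum]
    refine (Finset.sum_le_sum fun C hC => ?_).trans
      (Finset.sum_le_sum_of_subset_of_nonneg (Finset.filter_subset _ _) fun C _ _ => ?_)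
    · have hC0 : (fun i => (C 0 i, y i)) ∈ typeClass n k := by
        simpa [shell] using (Finset.mem_filter.1 hC).2
      rw [likelihood_eq_prod hC0]
      refine mul_le_mul_of_nonneg_left (Real.rpow_le_rpow (by positivity) ?_ hρ.le) (by positivity)
      rw [numCompetitors]
      refine Nat.cast_le.2 (Finset.card_le_card fun m hm => ?_)
      simp only [mem_filter, mem_univ, true_and, shell] at hm ⊢
      exact ⟨hm.1, (score_eq hs hC0 hm.2).le⟩
    · have := hlik (C 0) y
      positivity
  rw [moment, Finset.sum_comm]
  refine le_trans (le_trans (le_of_eq ?_) (Finset.sum_le_sum hterm))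
    (Finset.sum_le_sum_of_subset_of_nonneg (Finset.subset_univ U) fun y _ _ =>
      Finset.sum_nonneg fun C _ => ?_)
  · have hcancel : (T.card : ℝ)⁻¹ ^ (K + 1) * (T.card : ℝ) ^ (K + 1) = 1 := by
      rw [← mul_pow, inv_mul_cancel₀ hT0.ne', one_pow]
    set B := μ / (4 * (1 + μ)) * (max 1 (μ / 2)) ^ ρ
    rw [Finset.sum_const, nsmul_eq_mul]
    calc _ = ((T.card : ℝ)⁻¹ ^ (K + 1) * (T.card : ℝ) ^ (K + 1)) *
          (ℓ * ((typeClass n k).card / T.card) * B) := by rw [hcancel, one_mul]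
      _ = _ := by field_simp
  · have := hlik (C 0) y
    positivity

end Moment

/-! ### Logarithms of factorials and of type class sizes. -/

lemma mul_log_sub_le_log_factorial (m : ℕ) :
    (m : ℝ) * Real.log m - m ≤ Real.log m.factorial := by
  rcases Nat.eq_zero_or_pos m with rfl | hm
  · simp
  have hm' : (0 : ℝ) < m := by exact_mod_cast hm
  have hf : (0 : ℝ) < m.factorial := by exact_mod_cast m.factorial_pos
  have h := Real.pow_div_factorial_le_exp (m : ℝ) hm'.le m
  have h2 := Real.log_le_log (by positivity) h
  rw [Real.log_div (by positivity) hf.ne', Real.log_pow, Real.log_exp] at h2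
  linarith

/-- Induction from `(m + 1) log(1 + 1/m) ≥ 1`. The error has `log(m + 1)` rather than `log m` so
that it is nonnegative at `m = 0` and monotone in `m`. -/
lemma log_factorial_le (m : ℕ) :
    Real.log m.factorial ≤ (m : ℝ) * Real.log m - m + (1 + Real.log (m + 1)) := by
  rcases Nat.eq_zero_or_pos m with rfl | hm
  · simp
  have key : Real.log m.factorial ≤ (m : ℝ) * Real.log m - m + (1 + Real.log m) := by
    induction m, hm using Nat.le_induction with
    | base => simp
    | succ m hm ih =>
      have hm' : (0 : ℝ) < m := by exact_mod_cast hm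
      rw [Nat.factorial_succ, Nat.cast_mul, Real.log_mul (by positivity)
        (by exact_mod_cast m.factorial_pos.ne')]
      push_cast
      have h := Real.one_sub_inv_le_log_of_pos (x := ((m : ℝ) + 1) / m) (by positivity)
      rw [Real.log_div (by positivity) hm'.ne'] at h
      have h3 : (1 : ℝ) ≤ (m + 1) * (Real.log (m + 1) - Real.log m) := by
        calc (1 : ℝ) = (m + 1) * (1 - (((m : ℝ) + 1) / m)⁻¹) := by field_simp; ring
          _ ≤ _ := mul_le_mul_of_nonneg_left h (by positivity)
      linarith
  have hm' : (0 : ℝ) < m := by exact_mod_cast hm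
  have := Real.log_le_log hm' (by linarith : (m : ℝ) ≤ m + 1)
  linarith

section TypeClass

variable {A : Type*} [Fintype A] [DecidableEq A]

lemma log_card_typeClass {n : ℕ} {c : A → ℕ} (hc : ∑ a, c a = n) :
    Real.log (typeClass n c).card = Real.log n.factorial - ∑ a, Real.log (c a).factorial := by
  have hT : ((typeClass n c).card : ℝ) ≠ 0 := by
    exact_mod_cast (typeClass_nonempty hc).card_pos.ne'
  have h0 : ∀ a ∈ univ, ((c a).factorial : ℝ) ≠ 0 := fun a _ => by
    exact_mod_cast (c a).factorial_pos.ne'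
  rw [← card_typeClass_mul hc, Nat.cast_mul, Nat.cast_prod,
    Real.log_mul hT (Finset.prod_ne_zero_iff.2 h0), Real.log_prod h0]
  ring

lemma log_card_typeClass_le {n : ℕ} {c : A → ℕ} (hc : ∑ a, c a = n) :
    Real.log (typeClass n c).card ≤
      n * Real.log n - ∑ a, (c a : ℝ) * Real.log (c a) + (1 + Real.log (n + 1)) := by
  rw [log_card_typeClass hc]
  have h1 := log_factorial_le n
  have h2 := Finset.sum_le_sum fun a (_ : a ∈ univ) => mul_log_sub_le_log_factorial (c a)
  rw [Finset.sum_sub_distrib, ← Nat.cast_sum, hc] at h2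
  linarith

lemma le_log_card_typeClass {n : ℕ} {c : A → ℕ} (hc : ∑ a, c a = n) :
    n * Real.log n - ∑ a, (c a : ℝ) * Real.log (c a) - Fintype.card A * (1 + Real.log (n + 1)) ≤
      Real.log (typeClass n c).card := by
  rw [log_card_typeClass hc]
  have h1 := mul_log_sub_le_log_factorial n
  have h2 : ∑ a, Real.log (c a).factorial ≤
      ∑ a, ((c a : ℝ) * Real.log (c a) - c a + (1 + Real.log (n + 1))) := by
    refine Finset.sum_le_sum fun a _ => (log_factorial_le (c a)).trans ?_
    have : c a ≤ n := hc ▸ Finset.single_le_sum (fun _ _ => Nat.zero_le _) (mem_univ a)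
    have : (c a : ℝ) ≤ n := by exact_mod_cast this
    gcongr
  rw [Finset.sum_add_distrib, Finset.sum_sub_distrib, ← Nat.cast_sum, hc, Finset.sum_const,
    nsmul_eq_mul, Finset.card_univ] at h2
  linarith

end TypeClass

/-! ### The exponent contributed by one joint type. -/

section Exponent

variable {X Y : Type*} [Fintype X] [Fintype Y]

/-- The mutual information of a joint distribution. -/
def mutInfo (w : X → Y → ℝ) : ℝ :=
  ∑ x, ∑ y, w x y * Real.log (w x y) - ∑ x, (∑ y, w x y) * Real.log (∑ y, w x y) -
    ∑ y, (∑ x, w x y) * Real.log (∑ x, w x y)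

/-- The conditional divergence `D(V ‖ P | Q)` of a joint distribution `w = Q V` relative to a
channel `P`. -/
def chanDiv (P w : X → Y → ℝ) : ℝ :=
  ∑ x, ∑ y, (w x y * Real.log (w x y) - w x y * Real.log (P x y)) -
    ∑ x, (∑ y, w x y) * Real.log (∑ y, w x y)

lemma mul_div_log_div {n : ℝ} (hn : 0 < n) (k : ℝ) :
    n * (k / n * Real.log (k / n)) = k * Real.log k - k * Real.log n := by
  rcases eq_or_ne k 0 with rfl | hk
  · simp
  rw [Real.log_div hk hn.ne']; field_simp

lemma mul_mutInfo_div {n : ℝ} (hn : 0 < n) {k : X → Y → ℝ} (hk : ∑ x, ∑ y, k x y = n) :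
    n * mutInfo (fun x y => k x y / n) = n * Real.log n + ∑ x, ∑ y, k x y * Real.log (k x y) -
      ∑ x, (∑ y, k x y) * Real.log (∑ y, k x y) - ∑ y, (∑ x, k x y) * Real.log (∑ x, k x y) := by
  have hk' : ∑ y, ∑ x, k x y = n := by rw [Finset.sum_comm, hk]
  unfold mutInfo
  simp only [← Finset.sum_div, mul_sub, Finset.mul_sum, mul_div_log_div hn]
  simp only [Finset.sum_sub_distrib, ← Finset.sum_mul, hk, hk']
  ring

lemma mul_chanDiv_div {n : ℝ} (hn : 0 < n) (P k : X → Y → ℝ) :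
    n * chanDiv P (fun x y => k x y / n) = ∑ x, ∑ y, k x y * Real.log (k x y) -
      ∑ x, ∑ y, k x y * Real.log (P x y) - ∑ x, (∑ y, k x y) * Real.log (∑ y, k x y) := by
  unfold chanDiv
  have h : ∀ x y, n * (k x y / n * Real.log (P x y)) = k x y * Real.log (P x y) := fun x y => by
    field_simp
  simp only [← Finset.sum_div, mul_sub, Finset.mul_sum, mul_div_log_div hn, h]
  simp only [Finset.sum_sub_distrib, ← Finset.sum_mul]
  ring

lemma half_exp_le_floor {t : ℝ} (ht : 0 ≤ t) : Real.exp t / 2 ≤ (⌊Real.exp t⌋₊ : ℝ) := by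
  have h1 : (1 : ℝ) ≤ Real.exp t := Real.one_le_exp ht
  have h2 := Nat.lt_floor_add_one (Real.exp t)
  have h3 : 1 ≤ ⌊Real.exp t⌋₊ := Nat.le_floor (by simpa using h1)
  have h4 : (1 : ℝ) ≤ (⌊Real.exp t⌋₊ : ℝ) := by exact_mod_cast h3
  linarith

/-- Here `v` is the nominal logarithm of `μ` and `a * L` the subexponential error. The fraction
contributes `min 0 v`, because it is at least `min(1, μ)/8`, and the power contributes `ρ max 0 v`.
Numerical constants are absorbed by `L ≥ 1`. -/
lemma log_hits_ge {μ ρ v L : ℝ} (hμ : 0 < μ) (hρ : 0 < ρ) (hL : 1 ≤ L) {a : ℝ}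
    (ha : 0 ≤ a) (h : v - a * L ≤ Real.log μ) :
    min 0 v + ρ * max 0 v - (a + 3 + ρ * (a + 1)) * L ≤
      Real.log (μ / (4 * (1 + μ)) * (max 1 (μ / 2)) ^ ρ) := by
  have hlog2 : Real.log 2 ≤ 1 := by linarith [Real.log_two_lt_d9]
  have hM : 0 < max 1 (μ / 2) := by positivity
  rw [Real.log_mul (by positivity) (by positivity), Real.log_rpow hM]
  have h1 : min 0 (Real.log μ) - 3 ≤ Real.log (μ / (4 * (1 + μ))) := by
    have e : min 0 (Real.log μ) - 3 ≤ Real.log (min 1 μ / 8) := by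
      have h8 : Real.log 8 = 3 * Real.log 2 := by
        rw [show (8 : ℝ) = 2 ^ 3 by norm_num, Real.log_pow]; norm_num
      rw [Real.log_div (by positivity) (by norm_num), h8]
      rcases le_total 1 μ with h' | h'
      · rw [min_eq_left h', min_eq_left (Real.log_nonneg h'), Real.log_one]; linarith
      · rw [min_eq_right h', min_eq_right (Real.log_nonpos hμ.le h')]; linarith
    refine e.trans (Real.log_le_log (by positivity) ?_)
    rw [div_le_div_iff₀ (by norm_num) (by positivity)]
    rcases le_total 1 μ with h' | h'
    · rw [min_eq_left h']; linarith
    · rw [min_eq_right h']; nlinarith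
  have h2 : max 0 (Real.log μ) - 1 ≤ Real.log (max 1 (μ / 2)) := by
    rw [sub_le_iff_le_add, max_le_iff]
    constructor
    · have := Real.log_nonneg (le_max_left 1 (μ / 2)); linarith
    · have := Real.log_le_log (by positivity) (le_max_right 1 (μ / 2))
      rw [Real.log_div hμ.ne' (by norm_num)] at this
      linarith
  have haL : 0 ≤ a * L := by positivity
  have h3 : min 0 v - a * L ≤ min 0 (Real.log μ) := by
    refine le_min ?_ ?_
    · linarith [min_le_left 0 v]
    · linarith [min_le_right 0 v]
  have h4 : max 0 v - a * L ≤ max 0 (Real.log μ) := by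
    rw [sub_le_iff_le_add]
    refine max_le ?_ ?_
    · linarith [le_max_left 0 (Real.log μ)]
    · linarith [le_max_right 0 (Real.log μ)]
  have h5 : ρ * (max 0 v - (a + 1) * L) ≤ ρ * Real.log (max 1 (μ / 2)) :=
    mul_le_mul_of_nonneg_left (by linarith) hρ.le
  linarith

variable [DecidableEq X] [DecidableEq Y]

set_option maxHeartbeats 1000000 in
/-- A lower bound on the exponent of the moment from a single joint type. -/
lemma log_moment_ge {P : X → Y → ℝ} (hP : ∀ x y, 0 ≤ P x y) {ρ : ℝ} (hρ : 0 < ρ) {R : ℝ}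
    (hR : 0 < R) : ∃ C : ℝ, 0 ≤ C ∧ ∀ s : Score X Y, (s = mmiScore ∨ s = mlScore P) →
      ∀ (n : ℕ), 0 < n → ∀ (c : X → ℕ), ∑ a, c a = n → ∀ k : X → Y → ℕ,
      (∀ a, ∑ b, k a b = c a) → (∀ a b, P a b = 0 → k a b = 0) →
      -chanDiv P (fun x y => (k x y : ℝ) / n) + min 0 (R - mutInfo fun x y => (k x y : ℝ) / n) +
        ρ * max 0 (R - mutInfo fun x y => (k x y : ℝ) / n) - C * ((1 + Real.log (n + 1)) / n) ≤
      Real.log (moment P s n ⌊Real.exp (n * R)⌋₊ c ρ) / n := by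
  set N : ℝ := (Fintype.card (X × Y) : ℝ) with hN
  have hN0 : 0 ≤ N := by positivity
  -- `N + 1` is the error in `log(|T_k| / |T_c|)`. `N + 3` is the error in `log μ`: the class of
  -- `k`, the two marginal classes, and the floor in `K`; `log_hits_ge` then supplies the rest.
  refine ⟨(N + 1) + ((N + 3) + 3 + ρ * ((N + 3) + 1)), by positivity, ?_⟩
  intro s hs n hn c hc k hkc hkP
  have hn' : (0 : ℝ) < n := by exact_mod_cast hn
  set L := 1 + Real.log ((n : ℝ) + 1) with hL
  have hL1 : 1 ≤ L := by
    have : 0 ≤ Real.log ((n : ℝ) + 1) := Real.log_nonneg (by linarith)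
    linarith
  set K := ⌊Real.exp (n * R)⌋₊ with hK
  have hKh : Real.exp (n * R) / 2 ≤ (K : ℝ) := half_exp_le_floor (by positivity)
  have hK0' : (0 : ℝ) < K := lt_of_lt_of_le (by positivity) hKh
  have hK0 : 0 < K := by exact_mod_cast hK0'
  set k' : X × Y → ℕ := fun p => k p.1 p.2
  set d : Y → ℕ := fun b => ∑ a, k a b with hd
  have hkn : ∑ p, k' p = n := by
    rw [Fintype.sum_prod_type, ← hc]; exact Finset.sum_congr rfl fun a _ => hkc a
  have hdn : ∑ b, d b = n := by rw [← hkn, Fintype.sum_prod_type_right]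
  have hTk : (0 : ℝ) < (typeClass n k').card := by exact_mod_cast (typeClass_nonempty hkn).card_pos
  have hTc : (0 : ℝ) < (typeClass n c).card := by exact_mod_cast (typeClass_nonempty hc).card_pos
  have hTd : (0 : ℝ) < (typeClass n d).card := by exact_mod_cast (typeClass_nonempty hdn).card_pos
  set μ : ℝ := K * ((typeClass n k').card / ((typeClass n c).card * (typeClass n d).card)) with hμ
  have hμ0 : 0 < μ := by positivity
  have hm := moment_ge hP hs hK0 hρ hkn hkc (fun _ => rfl) hμ
  have hPk : ∀ p : X × Y, 0 < P p.1 p.2 ^ k' p := by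
    intro p
    rcases (hP p.1 p.2).eq_or_lt with h | h
    · simp [k', hkP _ _ h.symm]
    · positivity
  have hℓ : 0 < ∏ p : X × Y, P p.1 p.2 ^ k' p := Finset.prod_pos fun p _ => hPk p
  have hlogℓ : Real.log (∏ p : X × Y, P p.1 p.2 ^ k' p) = ∑ x, ∑ y, (k x y : ℝ) * Real.log (P x y) := by
    rw [Real.log_prod fun p _ => (hPk p).ne', Fintype.sum_prod_type]
    simp only [Real.log_pow, k']
  set B := μ / (4 * (1 + μ)) * (max 1 (μ / 2)) ^ ρ with hB
  have hB0 : 0 < B := by positivity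
  have hlm := Real.log_le_log (by positivity) hm
  rw [Real.log_mul (by positivity) hB0.ne', Real.log_mul hℓ.ne' (by positivity),
    Real.log_div hTk.ne' hTc.ne', hlogℓ] at hlm
  have bk := le_log_card_typeClass hkn
  have bc := log_card_typeClass_le hc
  have bd := log_card_typeClass_le hdn
  rw [Fintype.sum_prod_type, ← hN, ← hL] at bk
  rw [← hL] at bc bd
  have sc : ∀ x, ∑ y, (k x y : ℝ) = c x := fun x => by rw [← hkc x]; push_cast; rfl
  have sd : ∀ y, ∑ x, (k x y : ℝ) = d y := fun y => by simp only [hd]; push_cast; rfl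
  have hkn' : ∑ x, ∑ y, (k x y : ℝ) = n := by
    simp_rw [sc]; exact_mod_cast hc
  have eI := mul_mutInfo_div hn' hkn'
  have eD := mul_chanDiv_div hn' P fun x y => (k x y : ℝ)
  simp only [sc, sd] at eI eD
  set I := mutInfo fun x y => (k x y : ℝ) / n
  set D := chanDiv P fun x y => (k x y : ℝ) / n
  have hlogK : n * R - 1 ≤ Real.log K := by
    have := Real.log_le_log (by positivity) hKh
    rw [Real.log_div (by positivity) (by norm_num), Real.log_exp] at this
    linarith [Real.log_two_lt_d9]
  have hlogμ : n * (R - I) - (N + 3) * L ≤ Real.log μ := by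
    rw [hμ, Real.log_mul hK0'.ne' (by positivity), Real.log_div hTk.ne' (by positivity),
      Real.log_mul hTc.ne' hTd.ne']
    linarith only [bk, bc, bd, eI, hlogK, hL1]
  have hBl := log_hits_ge hμ0 hρ hL1 (by positivity) hlogμ
  rw [← hB] at hBl
  have emin : min 0 (n * (R - I)) = n * min 0 (R - I) := by
    rw [mul_min_of_nonneg _ _ hn'.le, mul_zero]
  have emax : max 0 (n * (R - I)) = n * max 0 (R - I) := by
    rw [mul_max_of_nonneg _ _ hn'.le, mul_zero]
  rw [emin, emax] at hBl
  rw [le_div_iff₀ hn']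
  rw [sub_mul, mul_assoc _ (L / n), div_mul_cancel₀ _ hn'.ne']
  linarith only [hBl, hlm, bk, bc, eD]

end Exponent

/-! ### Approximating joint distributions by joint types. -/

section Rounding

variable {X Y : Type*} [Fintype X] [Fintype Y]

/-- Round down and give the whole deficit, at most `|Y|`, to one coordinate where `v` is nonzero;
zeros of `v` are thus preserved. -/
lemma exists_nat_rounding {v : Y → ℝ} (hv : ∀ y, 0 ≤ v y) {c : ℕ} (hc : ∑ y, v y = c) :
    ∃ k : Y → ℕ, ∑ y, k y = c ∧ (∀ y, v y = 0 → k y = 0) ∧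
      ∀ y, |(k y : ℝ) - v y| ≤ Fintype.card Y := by
  classical
  by_cases h : ∀ y, v y = 0
  · refine ⟨fun _ => 0, ?_, fun _ _ => rfl, fun y => by simp [h]⟩
    have : (c : ℝ) = 0 := by rw [← hc]; simp [h]
    have : c = 0 := by exact_mod_cast this
    simp [this]
  push Not at h
  obtain ⟨y₀, hy₀⟩ := h
  have hfl : ∀ y, (⌊v y⌋₊ : ℝ) ≤ v y := fun y => Nat.floor_le (hv y)
  have hle : ∑ y, ⌊v y⌋₊ ≤ c := by
    have : ((∑ y, ⌊v y⌋₊ : ℕ) : ℝ) ≤ c := by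
      rw [← hc]; push_cast; exact Finset.sum_le_sum fun y _ => hfl y
    exact_mod_cast this
  obtain ⟨d, hd⟩ := Nat.exists_eq_add_of_le hle
  have hd' : (d : ℝ) ≤ Fintype.card Y := by
    have h1 : (d : ℝ) = ∑ y, (v y - ⌊v y⌋₊) := by
      rw [Finset.sum_sub_distrib, hc, hd]; push_cast; ring
    rw [h1]
    calc _ ≤ ∑ y : Y, (1 : ℝ) := Finset.sum_le_sum fun y _ => by
            linarith [Nat.lt_floor_add_one (v y)]
      _ = _ := by simp
  have hY : (1 : ℝ) ≤ Fintype.card Y := by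
    exact_mod_cast Fintype.card_pos_iff.2 ⟨y₀⟩
  refine ⟨fun y => ⌊v y⌋₊ + if y = y₀ then d else 0, ?_, ?_, ?_⟩
  · rw [Finset.sum_add_distrib, Finset.sum_ite_eq', if_pos (mem_univ _), hd]
  · intro y hy
    have : y ≠ y₀ := by rintro rfl; exact hy₀ hy
    simp [this, hy]
  · intro y
    have h1 := hfl y
    have h2 := Nat.lt_floor_add_one (v y)
    have h0 : (0 : ℝ) ≤ d := by positivity
    rw [abs_le]
    push_cast
    split_ifs <;> constructor <;> linarith

lemma continuous_mutInfo : Continuous (mutInfo : (X → Y → ℝ) → ℝ) := by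
  unfold mutInfo
  refine ((continuous_finsetSum _ fun x _ => continuous_finsetSum _ fun y _ => ?_).sub
    (continuous_finsetSum _ fun x _ => ?_)).sub (continuous_finsetSum _ fun y _ => ?_)
  · exact Real.continuous_mul_log.comp (by fun_prop : Continuous fun w : X → Y → ℝ => w x y)
  · exact Real.continuous_mul_log.comp (by fun_prop : Continuous fun w : X → Y → ℝ => ∑ y, w x y)
  · exact Real.continuous_mul_log.comp (by fun_prop : Continuous fun w : X → Y → ℝ => ∑ x, w x y)

/-- The convention `log 0 = 0` keeps the term in `log (P x y)` linear even where the channel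
vanishes. Infinite divergence is excluded separately, by `IsJoint.eq_zero`. -/
lemma continuous_chanDiv (P : X → Y → ℝ) : Continuous (chanDiv P) := by
  unfold chanDiv
  refine (continuous_finsetSum _ fun x _ => continuous_finsetSum _ fun y _ => ?_).sub
    (continuous_finsetSum _ fun x _ => ?_)
  · refine Continuous.sub ?_ (by fun_prop)
    exact Real.continuous_mul_log.comp (by fun_prop : Continuous fun w : X → Y → ℝ => w x y)
  · exact Real.continuous_mul_log.comp (by fun_prop : Continuous fun w : X → Y → ℝ => ∑ y, w x y)

/-- `w` is a joint distribution with input marginal `Q`, absolutely continuous with respect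
to the channel `P`. -/
structure IsJoint (P : X → Y → ℝ) (Q : X → ℝ) (w : X → Y → ℝ) : Prop where
  nonneg : ∀ x y, 0 ≤ w x y
  sum_eq : ∀ x, ∑ y, w x y = Q x
  eq_zero : ∀ x y, P x y = 0 → w x y = 0

/-- Rounding `n * w` row by row keeps the input marginal exact and moves each entry by `O(1/n)`.
Uniform continuity on the unit cube makes `n₀` independent of the type and of `w`. -/
lemma exists_joint_counts (P : X → Y → ℝ) {ε : ℝ} (hε : 0 < ε) :
    ∃ n₀ : ℕ, ∀ n ≥ n₀, 0 < n → ∀ c : X → ℕ, ∑ a, c a = n → ∀ w : X → Y → ℝ,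
      IsJoint P (fun a => (c a : ℝ) / n) w → ∃ k : X → Y → ℕ, (∀ a, ∑ b, k a b = c a) ∧
        (∀ a b, P a b = 0 → k a b = 0) ∧
        |chanDiv P (fun x y => (k x y : ℝ) / n) - chanDiv P w| ≤ ε ∧
        |mutInfo (fun x y => (k x y : ℝ) / n) - mutInfo w| ≤ ε := by
  set B : Set (X → Y → ℝ) := Set.Icc 0 1 with hB
  have hBc : IsCompact B := isCompact_Icc
  have h1 := hBc.uniformContinuousOn_of_continuous (continuous_chanDiv P).continuousOn
  have h2 := hBc.uniformContinuousOn_of_continuous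
    (continuous_mutInfo (X := X) (Y := Y)).continuousOn
  rw [Metric.uniformContinuousOn_iff_le] at h1 h2
  obtain ⟨δ₁, hδ₁, h1⟩ := h1 ε hε
  obtain ⟨δ₂, hδ₂, h2⟩ := h2 ε hε
  obtain ⟨n₀, hn₀⟩ := exists_nat_gt ((Fintype.card Y : ℝ) / min δ₁ δ₂)
  have hδ : 0 < min δ₁ δ₂ := lt_min hδ₁ hδ₂
  refine ⟨n₀, fun n hn hn0 c hc w hw => ?_⟩
  have hn' : (0 : ℝ) < n := by exact_mod_cast hn0
  have hr : ∀ a, ∃ k : Y → ℕ, ∑ y, k y = c a ∧ (∀ y, n * w a y = 0 → k y = 0) ∧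
      ∀ y, |(k y : ℝ) - n * w a y| ≤ Fintype.card Y := fun a =>
    exists_nat_rounding (fun y => mul_nonneg hn'.le (hw.nonneg a y)) (by
      rw [← Finset.mul_sum, hw.sum_eq]; field_simp)
  choose k hk1 hk2 hk3 using hr
  have hca : ∀ a, c a ≤ n := fun a => hc ▸ Finset.single_le_sum (fun _ _ => Nat.zero_le _) (mem_univ a)
  have hkn : ∀ a b, k a b ≤ n := fun a b =>
    ((hk1 a) ▸ Finset.single_le_sum (fun _ _ => Nat.zero_le _) (mem_univ b)).trans (hca a)
  have hwB : w ∈ B := by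
    refine ⟨fun x y => hw.nonneg x y, fun x y => ?_⟩
    calc w x y ≤ ∑ y, w x y := Finset.single_le_sum (fun y _ => hw.nonneg x y) (mem_univ y)
      _ = (c x : ℝ) / n := hw.sum_eq x
      _ ≤ 1 := by rw [div_le_one hn']; exact_mod_cast hca x
  have hkB : (fun x y => (k x y : ℝ) / n) ∈ B := by
    refine ⟨fun x y => ?_, fun x y => ?_⟩
    · simp only [Pi.zero_apply]; positivity
    · simp only [Pi.one_apply]; rw [div_le_one hn']; exact_mod_cast hkn x y
  have hdist : dist (fun x y => (k x y : ℝ) / n) w ≤ min δ₁ δ₂ := by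
    rw [dist_pi_le_iff hδ.le]; intro x
    rw [dist_pi_le_iff hδ.le]; intro y
    have e : (k x y : ℝ) / n - w x y = (k x y - n * w x y) / n := by field_simp
    rw [Real.dist_eq, e, abs_div, abs_of_pos hn', div_le_iff₀ hn']
    refine (hk3 x y).trans ?_
    rw [div_lt_iff₀ hδ] at hn₀
    have : (n₀ : ℝ) ≤ n := by exact_mod_cast hn
    nlinarith
  refine ⟨k, hk1, fun a b hab => hk2 a b (by rw [hw.eq_zero a b hab, mul_zero]), ?_, ?_⟩
  · exact h1 _ hkB _ hwB (hdist.trans (min_le_left _ _))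
  · exact h2 _ hkB _ hwB (hdist.trans (min_le_right _ _))

variable [DecidableEq X] [DecidableEq Y]

lemma tendsto_one_add_log_div (C : ℝ) :
    Tendsto (fun n : ℕ => C * ((1 + Real.log ((n : ℝ) + 1)) / n)) atTop (𝓝 0) := by
  have h1 : Tendsto (fun n : ℕ => ((n : ℝ))⁻¹) atTop (𝓝 0) := tendsto_inv_atTop_nhds_zero_nat
  have h2 : Tendsto (fun n : ℕ => Real.log ((n : ℝ) + 1) / ((n : ℝ) + 1)) atTop (𝓝 0) := by
    have := Real.isLittleO_log_id_atTop.tendsto_div_nhds_zero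
    have h3 : Tendsto (fun n : ℕ => (n : ℝ) + 1) atTop atTop :=
      tendsto_atTop_add_const_right _ _ tendsto_natCast_atTop_atTop
    exact this.comp h3
  have h3 : Tendsto (fun n : ℕ => C * ((n : ℝ)⁻¹ +
      Real.log ((n : ℝ) + 1) / ((n : ℝ) + 1) * (1 + (n : ℝ)⁻¹))) atTop (𝓝 (C * (0 + 0 * (1 + 0)))) :=
    (h1.add (h2.mul (h1.const_add 1))).const_mul C
  simp only [add_zero, zero_mul, mul_zero] at h3
  refine h3.congr' ?_
  filter_upwards [eventually_gt_atTop 0] with n hn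
  have : (0 : ℝ) < n := by exact_mod_cast hn
  field_simp

/-- Joint distributions with the right input marginals bound the moment exponent from below. -/
lemma le_momentExponent {P : X → Y → ℝ} (hP : ∀ x y, 0 ≤ P x y) {ρ : ℝ} (hρ : 0 < ρ) {R : ℝ}
    (hR : 0 < R) {s : Score X Y} (hs : s = mmiScore ∨ s = mlScore P) {c : ℕ → X → ℕ}
    (hc : ∀ n, ∑ a, c n a = n) {B : ℝ}
    (h : ∀ ε > 0, ∀ᶠ n : ℕ in atTop, ∃ w, IsJoint P (fun a => (c n a : ℝ) / n) w ∧
      B - ε ≤ -chanDiv P w + min 0 (R - mutInfo w) + ρ * max 0 (R - mutInfo w)) :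
    (B : EReal) ≤ momentExponent P s c R ρ := by
  rw [← EReal.ge_of_forall_gt_iff_ge]
  intro z hz
  have hz : z < B := by exact_mod_cast hz
  obtain ⟨C, hC, hmom⟩ := log_moment_ge hP hρ hR
  -- One `ε` each for the hypothesis, the divergence, the `min` term and the polynomial factors, and
  -- `ρ ε` for the `max` term.
  set ε := (B - z) / (4 + ρ) with hε
  have hε0 : 0 < ε := div_pos (by linarith) (by linarith)
  have hεe : (4 + ρ) * ε = B - z := by rw [hε]; field_simp
  obtain ⟨n₀, hn₀⟩ := exists_joint_counts P hε0
  refine le_liminf_of_le (by isBoundedDefault) ?_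
  filter_upwards [h ε hε0, eventually_ge_atTop n₀, eventually_gt_atTop 0,
    (tendsto_one_add_log_div C).eventually_lt_const hε0] with n hw hn hn0 hsmall
  obtain ⟨w, hw, hB⟩ := hw
  obtain ⟨k, hk1, hk2, hD, hI⟩ := hn₀ n hn hn0 (c n) (hc n) w hw
  have key := hmom s hs n hn0 (c n) (hc n) k hk1 hk2
  refine EReal.coe_le_coe_iff.2 (le_trans ?_ key)
  set D' := chanDiv P fun x y => (k x y : ℝ) / n
  set I' := mutInfo fun x y => (k x y : ℝ) / n
  rw [abs_le] at hD hI
  have h1 : min 0 (R - mutInfo w) - ε ≤ min 0 (R - I') := by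
    refine le_min ?_ ?_
    · linarith [min_le_left 0 (R - mutInfo w)]
    · linarith [min_le_right 0 (R - mutInfo w), hI.1, hI.2]
  have h2 : max 0 (R - mutInfo w) ≤ max 0 (R - I') + ε := by
    refine max_le ?_ ?_
    · linarith [le_max_left 0 (R - I')]
    · linarith [le_max_right 0 (R - I'), hI.1, hI.2]
  have h3 := mul_le_mul_of_nonneg_left h2 hρ.le
  linarith [hD.1, hD.2]

end Rounding

/-- The log-sum inequality. -/
lemma log_sum_inequality {ι : Type*} [Fintype ι] {a b : ι → ℝ} (ha : ∀ i, 0 ≤ a i)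
    (hb : ∀ i, 0 ≤ b i) (hab : ∀ i, b i = 0 → a i = 0) :
    (∑ i, a i) * Real.log (∑ i, a i) + ∑ i, a i * Real.log (b i) ≤
      ∑ i, a i * Real.log (a i) + (∑ i, a i) * Real.log (∑ i, b i) := by
  rcases (Finset.sum_nonneg fun i (_ : i ∈ univ) => ha i).eq_or_lt with h | h
  · have : ∀ i, a i = 0 := fun i =>
      (Finset.sum_eq_zero_iff_of_nonneg fun i _ => ha i).1 h.symm i (mem_univ i)
    simp [this]
  set S := ∑ i, a i
  have hbS : 0 < ∑ i, b i := by
    refine lt_of_le_of_ne (Finset.sum_nonneg fun i _ => hb i) fun h0 => h.ne ?_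
    have : ∀ i, b i = 0 := fun i =>
      (Finset.sum_eq_zero_iff_of_nonneg fun i _ => hb i).1 h0.symm i (mem_univ i)
    exact (Finset.sum_eq_zero fun i _ => hab i (this i)).symm
  set T := ∑ i, b i
  -- This is `log t ≤ t - 1` at `t = b i * S / (a i * T)`, multiplied by `a i`; the right side sums
  -- to zero.
  have key : ∀ i, a i * Real.log S + a i * Real.log (b i) - a i * Real.log (a i) -
      a i * Real.log T ≤ b i * (S / T) - a i := by
    intro i
    rcases (ha i).eq_or_lt with h0 | h0
    · rw [← h0]; simp only [zero_mul, sub_zero, add_zero]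
      exact mul_nonneg (hb i) (by positivity)
    · have hbi : 0 < b i := lt_of_le_of_ne (hb i) fun h1 => h0.ne' (hab i h1.symm)
      have h1 := Real.log_le_sub_one_of_pos (x := b i * (S / T) / a i) (by positivity)
      rw [Real.log_div (by positivity) h0.ne', Real.log_mul hbi.ne' (by positivity),
        Real.log_div h.ne' hbS.ne'] at h1
      have h2 := mul_le_mul_of_nonneg_left h1 h0.le
      have h3 : a i * (b i * (S / T) / a i - 1) = b i * (S / T) - a i := by field_simp
      rw [h3] at h2
      linarith
  have hsum := Finset.sum_le_sum fun i (_ : i ∈ univ) => key i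
  simp only [Finset.sum_sub_distrib, Finset.sum_add_distrib, ← Finset.sum_mul] at hsum
  have : T * (S / T) = S := by field_simp
  change S * Real.log S + _ - _ - S * Real.log T ≤ T * (S / T) - S at hsum
  linarith

/-! ### Gallager's function and its maximizing inputs. -/

section Gallager

variable {X Y : Type*} [Fintype X]

/-- The output vector `y ↦ ∑_x Q(x) P(y|x)^{1/(1+r)}` in Gallager's function. -/
def tiltedOutput (P : X → Y → ℝ) (r : ℝ) (Q : X → ℝ) (y : Y) : ℝ :=
  ∑ x, Q x * P x y ^ (1 / (1 + r))

variable {P : X → Y → ℝ}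

lemma tiltedOutput_nonneg (hP : ∀ x y, 0 ≤ P x y) {Q : X → ℝ} (hQ : Q ∈ stdSimplex ℝ X) (r : ℝ)
    (y : Y) : 0 ≤ tiltedOutput P r Q y :=
  Finset.sum_nonneg fun x _ => mul_nonneg (hQ.1 x) (Real.rpow_nonneg (hP x y) _)

lemma tiltedOutput_pos (hP : ∀ x y, 0 ≤ P x y) {Q : X → ℝ} (hQ : Q ∈ stdSimplex ℝ X) (r : ℝ)
    {x : X} {y : Y} (hx : 0 < Q x) (hy : 0 < P x y) : 0 < tiltedOutput P r Q y :=
  Finset.sum_pos' (fun x _ => mul_nonneg (hQ.1 x) (Real.rpow_nonneg (hP x y) _))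
    ⟨x, mem_univ x, mul_pos hx (Real.rpow_pos_of_pos hy _)⟩

variable [Fintype Y]

/-- The argument of the logarithm in Gallager's function. -/
def gallagerSum (P : X → Y → ℝ) (r : ℝ) (Q : X → ℝ) : ℝ :=
  ∑ y, tiltedOutput P r Q y ^ (1 + r)

lemma gallagerE0Q_eq (P : X → Y → ℝ) (r : ℝ) (Q : X → ℝ) :
    gallagerE0Q P r Q = -Real.log (gallagerSum P r Q) := rfl

lemma exists_pos_of_sum_eq_one {ι : Type*} [Fintype ι] {a : ι → ℝ} (h : ∑ i, a i = 1) :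
    ∃ i, 0 < a i := by
  by_contra! hc
  have := Finset.sum_nonpos fun i (_ : i ∈ univ) => hc i
  linarith

lemma gallagerSum_pos (hP : ∀ x y, 0 ≤ P x y) (hP1 : ∀ x, ∑ y, P x y = 1) {Q : X → ℝ}
    (hQ : Q ∈ stdSimplex ℝ X) (r : ℝ) : 0 < gallagerSum P r Q := by
  obtain ⟨x, hx⟩ := exists_pos_of_sum_eq_one hQ.2
  obtain ⟨y, hy⟩ := exists_pos_of_sum_eq_one (hP1 x)
  exact Finset.sum_pos' (fun y _ => Real.rpow_nonneg (tiltedOutput_nonneg hP hQ r y) _)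
    ⟨y, mem_univ y, Real.rpow_pos_of_pos (tiltedOutput_pos hP hQ r hx hy) _⟩

/-- Both exponents `1 / (1 + r)` and `1 + r` stay positive for `r ≥ 0`, so the real powers are
continuous even at zero bases. -/
lemma continuousOn_gallagerE0Q (hP : ∀ x y, 0 ≤ P x y) (hP1 : ∀ x, ∑ y, P x y = 1) :
    ContinuousOn (fun p : ℝ × (X → ℝ) => gallagerE0Q P p.1 p.2)
      (Set.Ici 0 ×ˢ stdSimplex ℝ X) := by
  simp only [gallagerE0Q_eq]
  refine (ContinuousOn.log ?_ fun p hp => (gallagerSum_pos hP hP1 hp.2 p.1).ne').neg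
  unfold gallagerSum tiltedOutput
  have h1 : ∀ p ∈ (Set.Ici (0 : ℝ) ×ˢ stdSimplex ℝ X), 0 < 1 + p.1 := fun p hp => by
    have : (0 : ℝ) ≤ p.1 := hp.1
    linarith
  refine continuousOn_finsetSum _ fun y _ => ContinuousOn.rpow
    (continuousOn_finsetSum _ fun x _ => ContinuousOn.mul (by fun_prop)
      (ContinuousOn.rpow continuousOn_const ?_ fun p hp => Or.inr ?_)) (by fun_prop)
      fun p hp => Or.inr (h1 p hp)
  · exact ContinuousOn.div continuousOn_const (by fun_prop) fun p hp => (h1 p hp).ne'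
  · have := h1 p hp; positivity

lemma exists_maximizer [Nonempty X] (hP : ∀ x y, 0 ≤ P x y) (hP1 : ∀ x, ∑ y, P x y = 1) {r : ℝ} (hr : 0 ≤ r) :
    ∃ Q ∈ stdSimplex ℝ X, ∀ Q' ∈ stdSimplex ℝ X, gallagerE0Q P r Q' ≤ gallagerE0Q P r Q := by
  classical
  have hne : (stdSimplex ℝ X).Nonempty := ⟨_, single_mem_stdSimplex ℝ (Classical.arbitrary X)⟩
  have hc : ContinuousOn (fun Q => gallagerE0Q P r Q) (stdSimplex ℝ X) :=
    (continuousOn_gallagerE0Q hP hP1).comp (f := fun Q => (r, Q)) (by fun_prop)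
      fun Q hQ => ⟨hr, hQ⟩
  exact (isCompact_stdSimplex ℝ X).exists_isMaxOn hne hc

lemma gallagerE0_eq_of_maximizer {r : ℝ} {Q : X → ℝ} (hQ : Q ∈ stdSimplex ℝ X)
    (h : ∀ Q' ∈ stdSimplex ℝ X, gallagerE0Q P r Q' ≤ gallagerE0Q P r Q) :
    gallagerE0 P r = gallagerE0Q P r Q := by
  have : Nonempty (stdSimplex ℝ X) := ⟨⟨Q, hQ⟩⟩
  refine le_antisymm (ciSup_le fun Q' => h _ Q'.2) ?_
  exact le_ciSup (f := fun Q : stdSimplex ℝ X => gallagerE0Q P r (Q : X → ℝ))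
    ⟨gallagerE0Q P r Q, by rintro _ ⟨Q', rfl⟩; exact h _ Q'.2⟩ ⟨Q, hQ⟩

lemma gallagerE0Q_le [Nonempty X] (hP : ∀ x y, 0 ≤ P x y) (hP1 : ∀ x, ∑ y, P x y = 1) {r : ℝ} (hr : 0 ≤ r)
    {Q : X → ℝ} (hQ : Q ∈ stdSimplex ℝ X) : gallagerE0Q P r Q ≤ gallagerE0 P r := by
  obtain ⟨Q', hQ', h⟩ := exists_maximizer hP hP1 hr
  rw [gallagerE0_eq_of_maximizer hQ' h]
  exact h Q hQ

/-- A point mass as input gives the value `0`. -/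
lemma gallagerE0_nonneg [Nonempty X] (hP : ∀ x y, 0 ≤ P x y) (hP1 : ∀ x, ∑ y, P x y = 1) {r : ℝ}
    (hr : 0 ≤ r) : 0 ≤ gallagerE0 P r := by
  classical
  obtain ⟨x⟩ := ‹Nonempty X›
  have : Nonempty X := ⟨x⟩
  refine le_trans (le_of_eq ?_) (gallagerE0Q_le hP hP1 hr (single_mem_stdSimplex ℝ x))
  have h1 : (0 : ℝ) < 1 + r := by linarith
  have : gallagerSum P r (Pi.single x 1) = 1 := by
    refine Eq.trans (Finset.sum_congr rfl fun y _ => ?_) (hP1 x)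
    have : tiltedOutput P r (Pi.single x 1) y = P x y ^ (1 / (1 + r)) := by
      unfold tiltedOutput
      rw [Finset.sum_eq_single x (fun b _ hb => by simp [hb]) (by simp)]
      simp
    rw [this, ← Real.rpow_mul (hP x y), one_div, inv_mul_cancel₀ h1.ne', Real.rpow_one]
  rw [gallagerE0Q_eq, this]; simp

/-- The optimality conditions for the maximization of Gallager's function over inputs. -/
lemma gallagerSum_le_of_maximizer (hP : ∀ x y, 0 ≤ P x y) (hP1 : ∀ x, ∑ y, P x y = 1) {r : ℝ}
    (hr : 0 ≤ r) {Q : X → ℝ} (hQ : Q ∈ stdSimplex ℝ X)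
    (h : ∀ Q' ∈ stdSimplex ℝ X, gallagerE0Q P r Q' ≤ gallagerE0Q P r Q) (x : X) :
    gallagerSum P r Q ≤ ∑ y, P x y ^ (1 / (1 + r)) * tiltedOutput P r Q y ^ r := by
  classical
  set α := tiltedOutput P r Q with hα
  set β : Y → ℝ := fun y => P x y ^ (1 / (1 + r)) with hβ
  have hα0 : ∀ y, 0 ≤ α y := tiltedOutput_nonneg hP hQ r
  have h1r : 0 < 1 + r := by linarith
  -- `f` is the Gallager sum along the segment from `Q` to the point mass at `x`. Maximality of `Q`
  -- makes `f` minimal at `0`, so its right derivative there is nonnegative; this is the claim up to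
  -- the factor `1 + r`.
  set f : ℝ → ℝ := fun t => ∑ y, (α y + t * (β y - α y)) ^ (1 + r) with hf
  have hf0 : f 0 = gallagerSum P r Q := by simp [hf, gallagerSum, hα]
  have hmin : ∀ t ∈ Set.Ioo (0 : ℝ) 1, f 0 ≤ f t := by
    intro t ht
    set Q' : X → ℝ := (1 - t) • Q + t • Pi.single x 1 with hQ'
    have hQ's : Q' ∈ stdSimplex ℝ X := convex_stdSimplex ℝ X hQ (single_mem_stdSimplex ℝ x)
      (by linarith [ht.2]) ht.1.le (by ring)
    have hft : f t = gallagerSum P r Q' := by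
      refine Finset.sum_congr rfl fun y _ => ?_
      congr 1
      have : tiltedOutput P r Q' y = (1 - t) * α y + t * β y := by
        simp only [tiltedOutput, hQ', hα, hβ, Pi.add_apply, Pi.smul_apply, smul_eq_mul, add_mul,
          Finset.sum_add_distrib, Finset.mul_sum, mul_assoc]
        congr 1
        rw [Finset.sum_eq_single x (fun b _ hb => by simp [hb]) (by simp)]
        simp
      rw [this]; ring
    have := h Q' hQ's
    rw [gallagerE0Q_eq, gallagerE0Q_eq, neg_le_neg_iff] at this
    rw [hf0, hft]
    exact (Real.log_le_log_iff (gallagerSum_pos hP hP1 hQ r) (gallagerSum_pos hP hP1 hQ's r)).1 this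
  have hderiv : HasDerivAt f (∑ y, (β y - α y) * (1 + r) * α y ^ r) 0 := by
    refine HasDerivAt.fun_sum fun y _ => ?_
    have h1 : HasDerivAt (fun t : ℝ => α y + t * (β y - α y)) (β y - α y) 0 := by
      simpa using ((hasDerivAt_id (0 : ℝ)).mul_const (β y - α y)).const_add (α y)
    have h2 := h1.rpow_const (p := 1 + r) (Or.inr (by linarith))
    simpa using h2
  have hnn : 0 ≤ ∑ y, (β y - α y) * (1 + r) * α y ^ r := by
    have ht := (hasDerivAt_iff_tendsto_slope_zero.1 hderiv).mono_left
      (nhdsWithin_mono 0 (fun t (ht : 0 < t) => ht.ne') : 𝓝[>] (0 : ℝ) ≤ 𝓝[≠] 0)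
    refine ge_of_tendsto ht ?_
    filter_upwards [Ioo_mem_nhdsGT (zero_lt_one' ℝ)] with t ht
    have := hmin t ht
    rw [zero_add, smul_eq_mul]
    exact mul_nonneg (inv_nonneg.2 ht.1.le) (by linarith)
  have e : ∑ y, (β y - α y) * (1 + r) * α y ^ r =
      (1 + r) * (∑ y, β y * α y ^ r - gallagerSum P r Q) := by
    rw [gallagerSum, ← Finset.sum_sub_distrib, Finset.mul_sum]
    refine Finset.sum_congr rfl fun y _ => ?_
    rw [Real.rpow_add' (hα0 y) h1r.ne', Real.rpow_one]; ring
  rw [e] at hnn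
  have := nonneg_of_mul_nonneg_right hnn h1r
  linarith

end Gallager

/-! ### Gallager's function against divergence plus information. -/

section Information

variable {X Y : Type*} [Fintype X] [Fintype Y] {P : X → Y → ℝ} {Q : X → ℝ} {w : X → Y → ℝ}

lemma IsJoint.chanDiv_eq (h : IsJoint P Q w) : chanDiv P w =
    ∑ x, ∑ y, (w x y * Real.log (w x y) - w x y * Real.log (P x y)) - ∑ x, Q x * Real.log (Q x) := by
  simp only [chanDiv, h.sum_eq]

lemma IsJoint.mutInfo_eq (h : IsJoint P Q w) : mutInfo w =
    ∑ x, ∑ y, w x y * Real.log (w x y) - ∑ x, Q x * Real.log (Q x) -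
      ∑ y, (∑ x, w x y) * Real.log (∑ x, w x y) := by
  simp only [mutInfo, h.sum_eq]

lemma IsJoint.chanDiv_nonneg (h : IsJoint P Q w) (hP : ∀ x y, 0 ≤ P x y)
    (hP1 : ∀ x, ∑ y, P x y = 1) : 0 ≤ chanDiv P w := by
  rw [chanDiv, ← Finset.sum_sub_distrib]
  refine Finset.sum_nonneg fun x _ => ?_
  have := log_sum_inequality (h.nonneg x) (hP x) (h.eq_zero x)
  rw [hP1, Real.log_one, mul_zero] at this
  rw [Finset.sum_sub_distrib]
  linarith

/-- Gallager's function bounds `D + r I` from below. -/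
lemma IsJoint.gallagerE0Q_le (h : IsJoint P Q w) (hP : ∀ x y, 0 ≤ P x y)
    (hQ : Q ∈ stdSimplex ℝ X) {r : ℝ} (hr : 0 ≤ r) :
    gallagerE0Q P r Q ≤ chanDiv P w + r * mutInfo w := by
  have h1r : 0 < 1 + r := by linarith
  set α := tiltedOutput P r Q with hα
  have hα0 : ∀ y, 0 ≤ α y := tiltedOutput_nonneg hP hQ r
  set q : Y → ℝ := fun y => ∑ x, w x y with hq
  have hq0 : ∀ y, 0 ≤ q y := fun y => Finset.sum_nonneg fun x _ => h.nonneg x y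
  have hwQ : ∀ x y, Q x = 0 → w x y = 0 := fun x y hx =>
    (Finset.sum_eq_zero_iff_of_nonneg fun y _ => h.nonneg x y).1
      ((h.sum_eq x).trans hx) y (mem_univ y)
  have hbz : ∀ x y, Q x * P x y ^ (1 / (1 + r)) = 0 → w x y = 0 := by
    intro x y h0
    rcases mul_eq_zero.1 h0 with h0 | h0
    · exact hwQ x y h0
    · exact h.eq_zero x y ((Real.rpow_eq_zero (hP x y) (by positivity)).1 h0)
  have hαq : ∀ y, α y = 0 → q y = 0 := by
    intro y h0
    have := (Finset.sum_eq_zero_iff_of_nonneg fun x _ =>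
      mul_nonneg (hQ.1 x) (Real.rpow_nonneg (hP x y) _)).1 h0
    exact Finset.sum_eq_zero fun x hx => hbz x y (this x hx)
  have hq1 : ∑ y, q y = 1 := by
    rw [hq, Finset.sum_comm]; simp only [h.sum_eq, hQ.2]
  -- Log-sum is used twice: over inputs for each `y` (`A`), then over outputs against `α^(1+r)`
  -- (`B`). The combination `(1 + r) A + B` is the result.
  have A := Finset.sum_le_sum fun y (_ : y ∈ univ) => log_sum_inequality (a := fun x => w x y)
    (b := fun x => Q x * P x y ^ (1 / (1 + r))) (fun x => h.nonneg x y)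
    (fun x => mul_nonneg (hQ.1 x) (Real.rpow_nonneg (hP x y) _)) (fun x => hbz x y)
  have elog : ∀ x y, w x y * Real.log (Q x * P x y ^ (1 / (1 + r))) =
      w x y * Real.log (Q x) + 1 / (1 + r) * (w x y * Real.log (P x y)) := by
    intro x y
    by_cases h0 : w x y = 0
    · simp [h0]
    · have hQx : Q x ≠ 0 := fun h' => h0 (hwQ x y h')
      have hPx : 0 < P x y := lt_of_le_of_ne (hP x y) fun h' => h0 (h.eq_zero x y h'.symm)
      rw [Real.log_mul hQx (by positivity), Real.log_rpow hPx]; ring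
  simp only [elog] at A
  rw [Finset.sum_add_distrib, Finset.sum_add_distrib, Finset.sum_comm,
    Finset.sum_comm (f := fun y x => w x y * Real.log (w x y))] at A
  have B := log_sum_inequality (a := q) (b := fun y => α y ^ (1 + r)) hq0
    (fun y => Real.rpow_nonneg (hα0 y) _)
    (fun y h0 => hαq y ((Real.rpow_eq_zero (hα0 y) h1r.ne').1 h0))
  rw [hq1, Real.log_one, one_mul, zero_add, one_mul] at B
  have elog2 : ∀ y, q y * Real.log (α y ^ (1 + r)) = (1 + r) * (q y * Real.log (α y)) := by
    intro y
    by_cases h0 : q y = 0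
    · simp [h0]
    · have : 0 < α y := lt_of_le_of_ne (hα0 y) fun h' => h0 (hαq y h'.symm)
      rw [Real.log_rpow this]; ring
  simp only [elog2, ← Finset.mul_sum] at B
  have hAQ : ∑ x, ∑ y, w x y * Real.log (Q x) = ∑ x, Q x * Real.log (Q x) :=
    Finset.sum_congr rfl fun x _ => by rw [← Finset.sum_mul, h.sum_eq]
  simp only [Finset.sum_add_distrib, ← Finset.mul_sum, hAQ] at A
  rw [gallagerE0Q_eq, gallagerSum, h.chanDiv_eq, h.mutInfo_eq]
  simp only [Finset.sum_sub_distrib]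
  have A' := mul_le_mul_of_nonneg_left A h1r.le
  have e3 : (1 + r) * (1 / (1 + r) * ∑ x, ∑ y, w x y * Real.log (P x y)) =
    ∑ x, ∑ y, w x y * Real.log (P x y) := by field_simp
  change (1 + r) * (∑ y, q y * Real.log (q y) + (_ + _)) ≤
    (1 + r) * (_ + ∑ y, q y * Real.log (α y)) at A'
  rw [mul_add (1 + r), mul_add (1 + r) (∑ x, Q x * Real.log (Q x)), e3] at A'
  linarith

/-- An optimal test channel for `D + r I`, whose value is bounded for every input. -/
lemma exists_testChannel [Nonempty X] (hP : ∀ x y, 0 ≤ P x y) (hP1 : ∀ x, ∑ y, P x y = 1) {r : ℝ}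
    (hr : 0 ≤ r) : ∃ V : X → Y → ℝ, (∀ x y, 0 ≤ V x y) ∧ (∀ x, ∑ y, V x y = 1) ∧
      (∀ x y, P x y = 0 → V x y = 0) ∧ ∀ Q ∈ stdSimplex ℝ X,
        chanDiv P (fun x y => Q x * V x y) + r * mutInfo (fun x y => Q x * V x y) ≤
          gallagerE0 P r := by
  have hφ : ∀ a b : ℝ, a * b * Real.log (a * b) = a * b * Real.log a + a * b * Real.log b := by
    intro a b
    rcases eq_or_ne a 0 with rfl | ha
    · simp
    rcases eq_or_ne b 0 with rfl | hb
    · simp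
    rw [Real.log_mul ha hb]; ring
  rcases hr.eq_or_lt with rfl | hr0
  -- At `r = 0` the channel itself has zero divergence. The case is split off because below `α y ^
  -- r` must vanish with `α y`.
  · refine ⟨P, hP, hP1, fun _ _ h => h, fun Q hQ => ?_⟩
    have hj : IsJoint P Q (fun x y => Q x * P x y) :=
      ⟨fun x y => mul_nonneg (hQ.1 x) (hP x y), fun x => by rw [← Finset.mul_sum, hP1, mul_one],
        fun x y h => by rw [h, mul_zero]⟩
    rw [zero_mul, add_zero, hj.chanDiv_eq]
    simp only [hφ]
    simp only [add_sub_cancel_right]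
    simp only [← Finset.sum_mul, ← Finset.mul_sum, hP1, mul_one, sub_self]
    exact gallagerE0_nonneg hP hP1 le_rfl
  obtain ⟨Q₀, hQ₀, hmax⟩ := exists_maximizer hP hP1 hr
  have h1r : 0 < 1 + r := by linarith
  set α := tiltedOutput P r Q₀ with hα
  have hα0 : ∀ y, 0 ≤ α y := tiltedOutput_nonneg hP hQ₀ r
  set F := gallagerSum P r Q₀ with hF
  have hF0 : 0 < F := gallagerSum_pos hP hP1 hQ₀ r
  set Z : X → ℝ := fun x => ∑ y, P x y ^ (1 / (1 + r)) * α y ^ r with hZ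
  have hZF : ∀ x, F ≤ Z x := gallagerSum_le_of_maximizer hP hP1 hr hQ₀ hmax
  have hZ0 : ∀ x, 0 < Z x := fun x => hF0.trans_le (hZF x)
  have hexp : 1 / (1 + r) ≠ 0 := by positivity
  -- For this tilted channel `D + r I` equals `r ((1 + r) ∑ q log α - ∑ q log q) - (1 + r) ∑ Q log
  -- Z`. Log-sum bounds the bracket by `log F`, and `Z x ≥ F` bounds the last sum, leaving `-log F`
  -- for every `Q`.
  set V : X → Y → ℝ := fun x y => P x y ^ (1 / (1 + r)) * α y ^ r / Z x with hV
  have hV0 : ∀ x y, 0 ≤ V x y := fun x y => div_nonneg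
    (mul_nonneg (Real.rpow_nonneg (hP x y) _) (Real.rpow_nonneg (hα0 y) _)) (hZ0 x).le
  have hV1 : ∀ x, ∑ y, V x y = 1 := fun x => by
    simp only [hV, ← Finset.sum_div]; exact div_self (hZ0 x).ne'
  have hVP : ∀ x y, P x y = 0 → V x y = 0 := fun x y h => by
    simp only [hV, h, Real.zero_rpow hexp, zero_mul, zero_div]
  have hVα : ∀ x y, α y = 0 → V x y = 0 := fun x y h => by
    simp only [hV, h, Real.zero_rpow hr0.ne', mul_zero, zero_div]
  refine ⟨V, hV0, hV1, hVP, fun Q hQ => ?_⟩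
  set w : X → Y → ℝ := fun x y => Q x * V x y with hw
  have hj : IsJoint P Q w := ⟨fun x y => mul_nonneg (hQ.1 x) (hV0 x y), fun x => by
    rw [← Finset.mul_sum, hV1, mul_one], fun x y h => by simp only [hw, hVP x y h, mul_zero]⟩
  set q : Y → ℝ := fun y => ∑ x, w x y with hq
  have hq0 : ∀ y, 0 ≤ q y := fun y => Finset.sum_nonneg fun x _ => hj.nonneg x y
  have hαq : ∀ y, α y = 0 → q y = 0 := fun y h0 =>
    Finset.sum_eq_zero fun x _ => by simp only [hw, hVα x y h0, mul_zero]
  have hq1 : ∑ y, q y = 1 := by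
    rw [hq, Finset.sum_comm]; simp only [hj.sum_eq, hQ.2]
  have B := log_sum_inequality (a := q) (b := fun y => α y ^ (1 + r)) hq0
    (fun y => Real.rpow_nonneg (hα0 y) _)
    (fun y h0 => hαq y ((Real.rpow_eq_zero (hα0 y) h1r.ne').1 h0))
  rw [hq1, Real.log_one, one_mul, zero_add, one_mul] at B
  change _ ≤ _ + Real.log F at B
  have elog2 : ∀ y, q y * Real.log (α y ^ (1 + r)) = (1 + r) * (q y * Real.log (α y)) := by
    intro y
    by_cases h0 : q y = 0
    · simp [h0]
    · have : 0 < α y := lt_of_le_of_ne (hα0 y) fun h' => h0 (hαq y h'.symm)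
      rw [Real.log_rpow this]; ring
  simp only [elog2, ← Finset.mul_sum] at B
  have elog : ∀ x y, w x y * Real.log (w x y) = w x y * Real.log (Q x) +
      (1 / (1 + r) * (w x y * Real.log (P x y)) + r * (w x y * Real.log (α y)) -
        w x y * Real.log (Z x)) := by
    intro x y
    rw [hw]
    simp only [hφ]
    congr 1
    by_cases h0 : V x y = 0
    · simp [h0]
    · have hPx : 0 < P x y := lt_of_le_of_ne (hP x y) fun h' => h0 (hVP x y h'.symm)
      have hαx : 0 < α y := lt_of_le_of_ne (hα0 y) fun h' => h0 (hVα x y h'.symm)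
      have : Real.log (V x y) = 1 / (1 + r) * Real.log (P x y) + r * Real.log (α y) -
          Real.log (Z x) := by
        simp only [hV]
        rw [Real.log_div (by positivity) (hZ0 x).ne', Real.log_mul (by positivity) (by positivity),
          Real.log_rpow hPx, Real.log_rpow hαx]
      rw [this]; ring
  have hAQ : ∑ x, ∑ y, w x y * Real.log (Q x) = ∑ x, Q x * Real.log (Q x) :=
    Finset.sum_congr rfl fun x _ => by rw [← Finset.sum_mul, hj.sum_eq]
  have hAZ : ∑ x, ∑ y, w x y * Real.log (Z x) = ∑ x, Q x * Real.log (Z x) :=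
    Finset.sum_congr rfl fun x _ => by rw [← Finset.sum_mul, hj.sum_eq]
  have hAα : ∑ x, ∑ y, w x y * Real.log (α y) = ∑ y, q y * Real.log (α y) := by
    rw [Finset.sum_comm]
    exact Finset.sum_congr rfl fun y _ => by rw [← Finset.sum_mul]
  have hZlog : Real.log F ≤ ∑ x, Q x * Real.log (Z x) := by
    calc Real.log F = ∑ x, Q x * Real.log F := by rw [← Finset.sum_mul, hQ.2, one_mul]
      _ ≤ _ := Finset.sum_le_sum fun x _ =>
        mul_le_mul_of_nonneg_left (Real.log_le_log hF0 (hZF x)) (hQ.1 x)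
  have hsum : ∑ x, ∑ y, w x y * Real.log (w x y) = ∑ x, Q x * Real.log (Q x) +
      (1 / (1 + r) * ∑ x, ∑ y, w x y * Real.log (P x y) + r * ∑ y, q y * Real.log (α y) -
        ∑ x, Q x * Real.log (Z x)) := by
    simp only [elog]
    simp only [Finset.sum_sub_distrib, Finset.sum_add_distrib, ← Finset.mul_sum, hAQ, hAZ, hAα]
  rw [gallagerE0_eq_of_maximizer hQ₀ hmax, gallagerE0Q_eq, hj.chanDiv_eq, hj.mutInfo_eq]
  simp only [Finset.sum_sub_distrib]
  change _ + r * (_ - _ - ∑ y, q y * Real.log (q y)) ≤ -Real.log F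
  rw [hsum]
  have e3 : (1 + r) * (1 / (1 + r) * ∑ x, ∑ y, w x y * Real.log (P x y)) =
    ∑ x, ∑ y, w x y * Real.log (P x y) := by field_simp
  have B' := mul_le_mul_of_nonneg_left B hr
  have Z' := mul_le_mul_of_nonneg_left hZlog h1r.le
  generalize 1 / (1 + r) * ∑ x, ∑ y, w x y * Real.log (P x y) = T at *
  rw [← e3]
  linarith

end Information

/-! ### Convex duality between test channels and the sphere-packing exponent. -/

section Duality

variable {X Y : Type*} [Fintype Y] {P : X → Y → ℝ} {Q : X → ℝ}

lemma IsJoint.convex {w w' : X → Y → ℝ} (h : IsJoint P Q w) (h' : IsJoint P Q w') {a b : ℝ}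
    (ha : 0 ≤ a) (hb : 0 ≤ b) (hab : a + b = 1) : IsJoint P Q (a • w + b • w') where
  nonneg x y := add_nonneg (mul_nonneg ha (h.nonneg x y)) (mul_nonneg hb (h'.nonneg x y))
  sum_eq x := by
    simp only [Pi.add_apply, Pi.smul_apply, smul_eq_mul, Finset.sum_add_distrib, ← Finset.mul_sum,
      h.sum_eq, h'.sum_eq]
    rw [← add_mul, hab, one_mul]
  eq_zero x y hxy := by simp [h.eq_zero x y hxy, h'.eq_zero x y hxy]

variable [Fintype X]

lemma IsJoint.chanDiv_convex {w w' : X → Y → ℝ} (h : IsJoint P Q w) (h' : IsJoint P Q w')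
    {a b : ℝ} (ha : 0 ≤ a) (hb : 0 ≤ b) (hab : a + b = 1) :
    chanDiv P (a • w + b • w') ≤ a * chanDiv P w + b * chanDiv P w' := by
  rw [(h.convex h' ha hb hab).chanDiv_eq, h.chanDiv_eq, h'.chanDiv_eq]
  have key : ∑ x, ∑ y, ((a • w + b • w') x y * Real.log ((a • w + b • w') x y) -
      (a • w + b • w') x y * Real.log (P x y)) ≤
      ∑ x, ∑ y, (a * (w x y * Real.log (w x y) - w x y * Real.log (P x y)) +
        b * (w' x y * Real.log (w' x y) - w' x y * Real.log (P x y))) := by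
    refine Finset.sum_le_sum fun x _ => Finset.sum_le_sum fun y _ => ?_
    have := Real.convexOn_mul_log.2 (Set.mem_Ici.2 (h.nonneg x y)) (Set.mem_Ici.2 (h'.nonneg x y))
      ha hb hab
    simp only [smul_eq_mul] at this
    simp only [Pi.add_apply, Pi.smul_apply, smul_eq_mul]
    linarith
  simp only [Finset.sum_add_distrib, ← Finset.mul_sum] at key
  linear_combination key + (∑ x, Q x * Real.log (Q x)) * hab

lemma IsJoint.mutInfo_eq' {w : X → Y → ℝ} (h : IsJoint P Q w) : mutInfo w =
    ∑ x, ∑ y, (w x y * Real.log (w x y) - w x y * Real.log (∑ x, w x y)) -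
      ∑ x, Q x * Real.log (Q x) := by
  rw [h.mutInfo_eq]
  simp only [Finset.sum_sub_distrib]
  have : ∑ x, ∑ y, w x y * Real.log (∑ x, w x y) = ∑ y, (∑ x, w x y) * Real.log (∑ x, w x y) := by
    rw [Finset.sum_comm]
    exact Finset.sum_congr rfl fun y _ => by rw [← Finset.sum_mul]
  rw [this]; ring

/-- Joint convexity of `u log (u / p)`: the two-term log-sum inequality. The bounds `u ≤ p` and `u'
≤ p'` supply absolute continuity. -/
lemma mul_log_div_convex {u u' p p' a b : ℝ} (hu : 0 ≤ u) (hu' : 0 ≤ u') (hp : u ≤ p)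
    (hp' : u' ≤ p') (ha : 0 ≤ a) (hb : 0 ≤ b) :
    (a * u + b * u') * Real.log (a * u + b * u') -
      (a * u + b * u') * Real.log (a * p + b * p') ≤
      a * (u * Real.log u - u * Real.log p) + b * (u' * Real.log u' - u' * Real.log p') := by
  have h := log_sum_inequality (a := ![a * u, b * u']) (b := ![a * p, b * p'])
    (fun i => by fin_cases i <;> simp <;> positivity)
    (fun i => by
      have := hu.trans hp
      have := hu'.trans hp'
      fin_cases i <;> simp <;> positivity)
    (fun i => by
      fin_cases i
      · simp only [Fin.zero_eta, Matrix.cons_val_zero, mul_eq_zero]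
        rintro (h | h)
        · exact Or.inl h
        · right; linarith
      · simp only [Fin.mk_one, Matrix.cons_val_one, Matrix.cons_val_fin_one, mul_eq_zero]
        rintro (h | h)
        · exact Or.inl h
        · right; linarith)
  simp only [Fin.sum_univ_two, Matrix.cons_val_zero, Matrix.cons_val_one,
    Matrix.cons_val_fin_one] at h
  have e : ∀ a u p : ℝ, 0 ≤ u → u ≤ p → a * u * Real.log (a * u) - a * u * Real.log (a * p) =
      a * (u * Real.log u - u * Real.log p) := by
    intro a u p hu hp
    rcases eq_or_ne a 0 with rfl | ha
    · simp
    rcases hu.eq_or_lt with rfl | hu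
    · simp
    rw [Real.log_mul ha hu.ne', Real.log_mul ha (hu.trans_le hp).ne']; ring
  have e1 := e a u p hu hp
  have e2 := e b u' p' hu' hp'
  linarith

lemma IsJoint.mutInfo_convex {w w' : X → Y → ℝ} (h : IsJoint P Q w) (h' : IsJoint P Q w')
    {a b : ℝ} (ha : 0 ≤ a) (hb : 0 ≤ b) (hab : a + b = 1) :
    mutInfo (a • w + b • w') ≤ a * mutInfo w + b * mutInfo w' := by
  rw [(h.convex h' ha hb hab).mutInfo_eq', h.mutInfo_eq', h'.mutInfo_eq']
  have key : ∑ x, ∑ y, ((a • w + b • w') x y * Real.log ((a • w + b • w') x y) -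
      (a • w + b • w') x y * Real.log (∑ x, (a • w + b • w') x y)) ≤
      ∑ x, ∑ y, (a * (w x y * Real.log (w x y) - w x y * Real.log (∑ x, w x y)) +
        b * (w' x y * Real.log (w' x y) - w' x y * Real.log (∑ x, w' x y))) := by
    refine Finset.sum_le_sum fun x _ => Finset.sum_le_sum fun y _ => ?_
    simp only [Pi.add_apply, Pi.smul_apply, smul_eq_mul, Finset.sum_add_distrib, ← Finset.mul_sum]
    exact mul_log_div_convex (h.nonneg x y) (h'.nonneg x y)
      (Finset.single_le_sum (f := fun x => w x y) (fun x _ => h.nonneg x y) (mem_univ x))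
      (Finset.single_le_sum (f := fun x => w' x y) (fun x _ => h'.nonneg x y) (mem_univ x)) ha hb
  simp only [Finset.sum_add_distrib, ← Finset.mul_sum] at key
  linear_combination key + (∑ x, Q x * Real.log (Q x)) * hab

lemma gallagerE0Q_sub_le_spherePacking {r : ℝ} (hr : 0 ≤ r) (hQ : Q ∈ stdSimplex ℝ X) (R : ℝ) :
    ((gallagerE0Q P r Q - r * R : ℝ) : EReal) ≤ spherePacking P R :=
  le_iSup₂_of_le (f := fun (r : {r : ℝ // 0 ≤ r}) (Q : stdSimplex ℝ X) =>
    ((gallagerE0Q P (r : ℝ) (Q : X → ℝ) - (r : ℝ) * R : ℝ) : EReal)) ⟨r, hr⟩ ⟨Q, hQ⟩ le_rfl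

lemma spherePacking_le {R : ℝ} {E : EReal} (h : ∀ r : ℝ, 0 ≤ r → ∀ Q ∈ stdSimplex ℝ X,
    ((gallagerE0Q P r Q - r * R : ℝ) : EReal) ≤ E) : spherePacking P R ≤ E :=
  iSup₂_le fun r Q => h r r.2 Q Q.2

variable [Nonempty X]

lemma gallagerE0_sub_le_spherePacking (hP : ∀ x y, 0 ≤ P x y) (hP1 : ∀ x, ∑ y, P x y = 1)
    {r : ℝ} (hr : 0 ≤ r) (R : ℝ) :
    ((gallagerE0 P r - r * R : ℝ) : EReal) ≤ spherePacking P R := by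
  obtain ⟨Q, hQ, hmax⟩ := exists_maximizer hP hP1 hr
  rw [gallagerE0_eq_of_maximizer hQ hmax]
  exact gallagerE0Q_sub_le_spherePacking hr hQ R

lemma spherePacking_nonneg (hP : ∀ x y, 0 ≤ P x y) (hP1 : ∀ x, ∑ y, P x y = 1) (R : ℝ) :
    0 ≤ spherePacking P R := by
  refine le_trans ?_ (gallagerE0_sub_le_spherePacking hP hP1 le_rfl R)
  have := gallagerE0_nonneg hP hP1 (le_refl (0 : ℝ))
  rw [zero_mul, sub_zero]
  exact_mod_cast this

/-- The sphere-packing exponent bounds the divergence of some test channel of rate about `r`,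
for every input distribution. -/
lemma exists_joint_of_spherePacking_le (hP : ∀ x y, 0 ≤ P x y) (hP1 : ∀ x, ∑ y, P x y = 1)
    {r E : ℝ} (hE : spherePacking P r ≤ E) (hQ : Q ∈ stdSimplex ℝ X) {ε : ℝ} (hε : 0 < ε) :
    ∃ w, IsJoint P Q w ∧ chanDiv P w ≤ E + ε ∧ mutInfo w ≤ r + ε := by
  have hE0 : 0 ≤ E := by exact_mod_cast (spherePacking_nonneg hP hP1 r).trans hE
  have htest : ∀ ϱ : ℝ, 0 ≤ ϱ → ∃ w, IsJoint P Q w ∧ chanDiv P w + ϱ * mutInfo w ≤ E + ϱ * r := by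
    intro ϱ hϱ
    obtain ⟨V, hV0, hV1, hVP, hV⟩ := exists_testChannel hP hP1 hϱ
    refine ⟨fun x y => Q x * V x y, ⟨fun x y => mul_nonneg (hQ.1 x) (hV0 x y), fun x => by
      rw [← Finset.mul_sum, hV1, mul_one], fun x y h => by rw [hVP x y h, mul_zero]⟩,
      (hV Q hQ).trans ?_⟩
    have : ((gallagerE0 P ϱ - ϱ * r : ℝ) : EReal) ≤ (E : EReal) :=
      (gallagerE0_sub_le_spherePacking hP hP1 hϱ r).trans hE
    have := EReal.coe_le_coe_iff.1 this
    linarith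
  by_contra! hno
  -- The upward closure of the attainable pairs `(D, I)`. If the claim fails, it misses an open
  -- quadrant, and a line separates the two; upward closure makes both coefficients of that line
  -- nonnegative.
  set A : Set (ℝ × ℝ) := {p | ∃ w, IsJoint P Q w ∧ chanDiv P w ≤ p.1 ∧ mutInfo w ≤ p.2} with hA
  have hAc : Convex ℝ A := by
    rintro p ⟨w, hw, h1, h2⟩ p' ⟨w', hw', h1', h2'⟩ a b ha hb hab
    refine ⟨a • w + b • w', hw.convex hw' ha hb hab,
      (hw.chanDiv_convex hw' ha hb hab).trans ?_, (hw.mutInfo_convex hw' ha hb hab).trans ?_⟩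
    · exact add_le_add (mul_le_mul_of_nonneg_left h1 ha) (mul_le_mul_of_nonneg_left h1' hb)
    · exact add_le_add (mul_le_mul_of_nonneg_left h2 ha) (mul_le_mul_of_nonneg_left h2' hb)
  obtain ⟨f, u, hfu, huf⟩ := geometric_hahn_banach_open (s := Set.Iio (E + ε) ×ˢ Set.Iio (r + ε))
    ((convex_Iio (𝕜 := ℝ) _).prod (convex_Iio _)) (isOpen_Iio.prod isOpen_Iio) hAc (by
      rw [Set.disjoint_left]
      rintro p ⟨hp1, hp2⟩ ⟨w, hw, h1, h2⟩
      have h3 := hno w hw (h1.trans (le_of_lt hp1))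
      exact absurd (h2.trans_lt hp2) (not_lt.2 h3.le))
  set α := f (1, 0) with hα
  set β := f (0, 1) with hβ
  have hf : ∀ a b : ℝ, f (a, b) = a * α + b * β := by
    intro a b
    have : ((a, b) : ℝ × ℝ) = a • (1, 0) + b • (0, 1) := by simp
    rw [this, map_add, map_smul, map_smul, smul_eq_mul, smul_eq_mul]
  obtain ⟨w₀, hw₀, -⟩ := htest 0 le_rfl
  have hα0 : 0 ≤ α := by
    by_contra! hneg
    have h := fun t : ℝ => fun ht : 0 ≤ t => huf (chanDiv P w₀ + t, mutInfo w₀)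
      ⟨w₀, hw₀, by simpa using ht, le_rfl⟩
    simp only [hf] at h
    obtain ⟨t, ht⟩ := exists_nat_gt ((chanDiv P w₀ * α + mutInfo w₀ * β - u) / (-α))
    rw [div_lt_iff₀ (by linarith)] at ht
    have := h t (by positivity)
    linarith
  have hβ0 : 0 ≤ β := by
    by_contra! hneg
    have h := fun t : ℝ => fun ht : 0 ≤ t => huf (chanDiv P w₀, mutInfo w₀ + t)
      ⟨w₀, hw₀, le_rfl, by simpa using ht⟩
    simp only [hf] at h
    obtain ⟨t, ht⟩ := exists_nat_gt ((chanDiv P w₀ * α + mutInfo w₀ * β - u) / (-β))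
    rw [div_lt_iff₀ (by linarith)] at ht
    have := h t (by positivity)
    linarith
  have hsep : ∀ w, IsJoint P Q w →
      (E + ε / 2) * α + (r + ε / 2) * β < chanDiv P w * α + mutInfo w * β := by
    intro w hw
    have h1 := hfu (E + ε / 2, r + ε / 2) ⟨by simp [hε], by simp [hε]⟩
    have h2 := huf (chanDiv P w, mutInfo w) ⟨w, hw, le_rfl, le_rfl⟩
    rw [hf] at h1 h2
    linarith
  -- If `α = 0`, every `w` has information above `r + ε/2`; as `D ≥ 0`, the test channel with slope
  -- `2 (E + 1) / ε` violates its bound. Otherwise the slope `β / α` gives the contradiction.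
  rcases hα0.eq_or_lt with h0 | hpos
  · have hβpos : 0 < β := by
      refine lt_of_le_of_ne hβ0 fun h => ?_
      have := hsep w₀ hw₀
      rw [← h0, ← h] at this
      simp at this
    obtain ⟨w, hw, hle⟩ := htest (2 * (E + 1) / ε) (by positivity)
    have h1 := hsep w hw
    rw [← h0, mul_zero, mul_zero, zero_add, zero_add] at h1
    have h2 := lt_of_mul_lt_mul_right h1 hβ0
    have h3 := hw.chanDiv_nonneg hP hP1
    have h4 : 2 * (E + 1) / ε * (r + ε / 2) ≤ 2 * (E + 1) / ε * mutInfo w :=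
      mul_le_mul_of_nonneg_left h2.le (by positivity)
    have h5 : 2 * (E + 1) / ε * (r + ε / 2) = 2 * (E + 1) / ε * r + (E + 1) := by field_simp
    linarith
  · obtain ⟨w, hw, hle⟩ := htest (β / α) (by positivity)
    have h1 := hsep w hw
    have h2 := mul_le_mul_of_nonneg_right hle hpos.le
    have h3 : (chanDiv P w + β / α * mutInfo w) * α = chanDiv P w * α + mutInfo w * β := by
      field_simp
    have h4 : (E + β / α * r) * α = E * α + r * β := by field_simp
    have h5 : 0 < ε / 2 * α := by positivity
    have h6 : 0 ≤ ε / 2 * β := by positivity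
    linarith

end Duality

/-! ### Evaluating the supremum over `λ`. -/

section MomentBound

variable {X Y : Type*} [Fintype X] [Fintype Y] {P : X → Y → ℝ}

lemma coe_le_momentBound {R ρ l b : ℝ} (hl : l ∈ Set.Ioo 0 R)
    (h : spherePacking P (R - l) ≤ b) : ((ρ * l - b : ℝ) : EReal) ≤ momentBound P R ρ := by
  refine le_trans ?_ (le_iSup (fun l : Set.Ioo (0 : ℝ) R =>
    ((ρ * (l : ℝ) : ℝ) : EReal) - spherePacking P (R - (l : ℝ))) ⟨l, hl⟩)
  rw [EReal.coe_sub]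
  exact EReal.sub_le_sub le_rfl h

lemma momentBound_le {R ρ B : ℝ} (h : ∀ l ∈ Set.Ioo (0 : ℝ) R,
    ((ρ * l - B : ℝ) : EReal) ≤ spherePacking P (R - l)) : momentBound P R ρ ≤ B := by
  refine iSup_le fun l => ?_
  refine (EReal.sub_le_sub le_rfl (h l l.2)).trans ?_
  rw [← EReal.coe_sub]
  exact EReal.coe_le_coe_iff.2 (by linarith)

lemma spherePacking_antitone (P : X → Y → ℝ) : Antitone (spherePacking P) := by
  intro R R' hRR'
  refine spherePacking_le fun r hr Q hQ => le_trans (EReal.coe_le_coe_iff.2 ?_)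
    (gallagerE0Q_sub_le_spherePacking hr hQ R)
  have := mul_le_mul_of_nonneg_left hRR' hr
  linarith

lemma spherePacking_convex {R R' E E' θ : ℝ} (h : spherePacking P R ≤ E)
    (h' : spherePacking P R' ≤ E') (h0 : 0 ≤ θ) (h1 : θ ≤ 1) :
    spherePacking P ((1 - θ) * R + θ * R') ≤ ((1 - θ) * E + θ * E' : ℝ) := by
  refine spherePacking_le fun r hr Q hQ => EReal.coe_le_coe_iff.2 ?_
  have a := EReal.coe_le_coe_iff.1 ((gallagerE0Q_sub_le_spherePacking hr hQ R).trans h)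
  have a' := EReal.coe_le_coe_iff.1 ((gallagerE0Q_sub_le_spherePacking hr hQ R').trans h')
  have b := mul_le_mul_of_nonneg_left a (sub_nonneg.2 h1)
  have b' := mul_le_mul_of_nonneg_left a' h0
  linarith

variable [Nonempty X]

lemma exists_coe_eq_spherePacking (hP : ∀ x y, 0 ≤ P x y) (hP1 : ∀ x, ∑ y, P x y = 1) {R : ℝ}
    (h : spherePacking P R ≠ ⊤) : ∃ E : ℝ, 0 ≤ E ∧ spherePacking P R = E := by
  have h0 := spherePacking_nonneg hP hP1 R
  have hbot : spherePacking P R ≠ ⊥ := fun h' => by simp [h'] at h0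
  refine ⟨(spherePacking P R).toReal, EReal.toReal_nonneg h0, (EReal.coe_toReal h hbot).symm⟩

/-- Finiteness at `r₀` bounds the objective at `R` by `E - r' (R - r₀)`, which is at most `0` once
`r' ≥ M`. The search is thus over a compact set. -/
lemma exists_isAchiever (hP : ∀ x y, 0 ≤ P x y) (hP1 : ∀ x, ∑ y, P x y = 1) {R r₀ : ℝ}
    (hr₀ : r₀ < R) (hfin : spherePacking P r₀ ≠ ⊤) : ∃ r, IsAchiever P R r := by
  obtain ⟨E, hE0, hE⟩ := exists_coe_eq_spherePacking hP hP1 hfin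
  have hpos : 0 < R - r₀ := by linarith
  set M := E / (R - r₀) with hM
  have hM0 : 0 ≤ M := by positivity
  have hMe : M * (R - r₀) = E := by rw [hM]; field_simp
  obtain ⟨Q₀, hQ₀, hmax₀⟩ := exists_maximizer hP hP1 (le_refl (0 : ℝ))
  have hK : IsCompact (Set.Icc 0 M ×ˢ stdSimplex ℝ X) := isCompact_Icc.prod (isCompact_stdSimplex ℝ X)
  have hc : ContinuousOn (fun p : ℝ × (X → ℝ) => gallagerE0Q P p.1 p.2 - p.1 * R)
      (Set.Icc 0 M ×ˢ stdSimplex ℝ X) :=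
    ((continuousOn_gallagerE0Q hP hP1).mono
      (Set.prod_mono Set.Icc_subset_Ici_self subset_rfl)).sub (by fun_prop)
  obtain ⟨⟨r, Q⟩, ⟨hr, hQ⟩, hmax⟩ := hK.exists_isMaxOn ⟨(0, Q₀), ⟨le_rfl, hM0⟩, hQ₀⟩ hc
  have hr0 : 0 ≤ r := hr.1
  refine ⟨r, hr0, le_antisymm (gallagerE0_sub_le_spherePacking hP hP1 hr0 R) ?_⟩
  refine le_trans (spherePacking_le (E := ((gallagerE0Q P r Q - r * R : ℝ) : EReal)) ?_)
    (EReal.coe_le_coe_iff.2 (by linarith [gallagerE0Q_le hP hP1 hr0 hQ]))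
  intro r' hr' Q' hQ'
  refine EReal.coe_le_coe_iff.2 ?_
  rcases le_total r' M with hle | hle
  · exact hmax (a := (r', Q')) ⟨⟨hr', hle⟩, hQ'⟩
  · have h1 : gallagerE0Q P 0 Q₀ - 0 * R ≤ gallagerE0Q P r Q - r * R :=
      hmax (a := (0, Q₀)) ⟨⟨le_rfl, hM0⟩, hQ₀⟩
    have h2 := gallagerE0_nonneg hP hP1 (le_refl (0 : ℝ))
    rw [gallagerE0_eq_of_maximizer hQ₀ hmax₀] at h2
    have h3 := EReal.coe_le_coe_iff.1 ((gallagerE0Q_sub_le_spherePacking hr' hQ' r₀).trans hE.le)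
    have h4 := mul_le_mul_of_nonneg_right hle hpos.le
    linarith

lemma neg_spherePacking_le_momentBound (hP : ∀ x y, 0 ≤ P x y) (hP1 : ∀ x, ∑ y, P x y = 1)
    {R r₀ ρ : ℝ} (hR : 0 < R) (hρ : 0 < ρ) (hr₀ : r₀ < R) (hfin : spherePacking P r₀ ≠ ⊤) :
    -spherePacking P R ≤ momentBound P R ρ := by
  obtain ⟨E', hE'0, hE'⟩ := exists_coe_eq_spherePacking hP hP1 hfin
  have hfinR : spherePacking P R ≠ ⊤ := fun h => by
    have := spherePacking_antitone P hr₀.le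
    rw [h, hE'] at this
    exact absurd this (by simp)
  obtain ⟨E, hE0, hE⟩ := exists_coe_eq_spherePacking hP hP1 hfinR
  rw [hE, ← EReal.coe_neg, ← EReal.ge_of_forall_gt_iff_ge]
  intro z hz
  have hz : z < -E := EReal.coe_lt_coe_iff.1 hz
  have hpos : 0 < R - r₀ := by linarith
  -- The rate moves a fraction `t` of the way to `r₀`, so `λ = t (R - r₀)`. The bounds on `t` permit
  -- convexity, keep the loss `t E'` below `-E - z`, and keep `λ ≤ R/2`.
  set t := min (min 1 ((-E - z) / (E' + 1))) (R / (2 * (R - r₀))) with ht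
  have hη : 0 < -E - z := by linarith
  have ht0 : 0 < t := by positivity
  have ht1 : t ≤ 1 := (min_le_left _ _).trans (min_le_left _ _)
  have htη : t * (E' + 1) ≤ -E - z :=
    (le_div_iff₀ (by positivity)).1 ((min_le_left _ _).trans (min_le_right _ _))
  have htR : t * (2 * (R - r₀)) ≤ R := (le_div_iff₀ (by positivity)).1 (min_le_right _ _)
  have hl0 : 0 < t * (R - r₀) := by positivity
  have hconv := spherePacking_convex hE.le hE'.le ht0.le ht1
  rw [show (1 - t) * R + t * r₀ = R - t * (R - r₀) by ring] at hconv
  refine le_trans (EReal.coe_le_coe_iff.2 ?_)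
    (coe_le_momentBound (ρ := ρ) ⟨hl0, by linarith⟩ hconv)
  have h1 : 0 < ρ * (t * (R - r₀)) := by positivity
  have h2 : 0 ≤ t * E := by positivity
  linarith

/-- The achiever's supporting line gives `E_sp(R - λ) ≥ E_sp(R) + rλ`, so `ρ ≤ r` makes small `λ`
best. -/
lemma momentBound_eq_neg_spherePacking (hP : ∀ x y, 0 ≤ P x y) (hP1 : ∀ x, ∑ y, P x y = 1)
    {R r₀ ρ r : ℝ} (hR : 0 < R) (hρ : 0 < ρ) (hr₀ : r₀ < R) (hfin : spherePacking P r₀ ≠ ⊤)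
    (hr : IsAchiever P R r) (hρr : ρ ≤ r) : momentBound P R ρ = -spherePacking P R := by
  refine le_antisymm ?_ (neg_spherePacking_le_momentBound hP hP1 hR hρ hr₀ hfin)
  rw [← hr.2, ← EReal.coe_neg]
  refine momentBound_le fun l hl => le_trans (EReal.coe_le_coe_iff.2 ?_)
    (gallagerE0_sub_le_spherePacking hP hP1 hr.1 (R - l))
  have := mul_le_mul_of_nonneg_right hρr hl.1.le
  linarith

/-- At a negative rate the objective grows without bound in the slope. -/
lemma IsAchiever.rate_nonneg (hP : ∀ x y, 0 ≤ P x y) (hP1 : ∀ x, ∑ y, P x y = 1) {R r : ℝ}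
    (h : IsAchiever P R r) : 0 ≤ R := by
  by_contra! hneg
  obtain ⟨t, ht⟩ := exists_nat_gt ((gallagerE0 P r - r * R) / (-R))
  rw [div_lt_iff₀ (by linarith)] at ht
  have h1 := gallagerE0_sub_le_spherePacking hP hP1 (Nat.cast_nonneg t) R
  rw [← h.2] at h1
  have h2 := EReal.coe_le_coe_iff.1 h1
  have h3 := gallagerE0_nonneg hP hP1 (Nat.cast_nonneg (α := ℝ) t)
  linarith

lemma IsAchiever.rate_le (hP : ∀ x y, 0 ≤ P x y) (hP1 : ∀ x, ∑ y, P x y = 1) {R R' r r' : ℝ}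
    (h : IsAchiever P R r) (h' : IsAchiever P R' r') (hrr' : r < r') : R' ≤ R := by
  have h1 := gallagerE0_sub_le_spherePacking hP hP1 h.1 R'
  have h2 := gallagerE0_sub_le_spherePacking hP hP1 h'.1 R
  rw [← h'.2] at h1
  rw [← h.2] at h2
  have h1 := EReal.coe_le_coe_iff.1 h1
  have h2 := EReal.coe_le_coe_iff.1 h2
  have : (r' - r) * R' ≤ (r' - r) * R := by linarith
  exact le_of_mul_le_mul_left this (by linarith)

/-- The line of slope `ρ` bounds every term above, with equality at `λ = R - R'` when that is
admissible. If `R' = R`, the limit `λ → 0` replaces it; otherwise `λ` is lowered by `δ`, which keeps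
it below `R` even if `R' = 0`. -/
lemma momentBound_eq_sub_gallagerE0 (hP : ∀ x y, 0 ≤ P x y) (hP1 : ∀ x, ∑ y, P x y = 1)
    {R r₀ ρ r R' : ℝ} (hR : 0 < R) (hρ : 0 < ρ) (hr₀ : r₀ < R) (hfin : spherePacking P r₀ ≠ ⊤)
    (hr : IsAchiever P R r) (hrρ : r < ρ) (hR' : IsAchiever P R' ρ) :
    momentBound P R ρ = ((ρ * R - gallagerE0 P ρ : ℝ) : EReal) := by
  refine le_antisymm ?_ ?_
  · refine momentBound_le fun l hl => le_trans (EReal.coe_le_coe_iff.2 ?_)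
      (gallagerE0_sub_le_spherePacking hP hP1 hρ.le (R - l))
    linarith
  have h0 := hR'.rate_nonneg hP hP1
  rcases (hr.rate_le hP hP1 hR' hrρ).eq_or_lt with rfl | hlt
  · have := neg_spherePacking_le_momentBound hP hP1 hR hρ hr₀ hfin
    rw [← hR'.2, ← EReal.coe_neg, neg_sub] at this
    exact this
  rw [← EReal.ge_of_forall_gt_iff_ge]
  intro z hz
  have hz := sub_pos.2 (EReal.coe_lt_coe_iff.1 hz)
  have hd := sub_pos.2 hlt
  set δ := min ((R - R') / 2) ((ρ * R - gallagerE0 P ρ - z) / ρ) with hδ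
  have hδ0 : 0 < δ := by positivity
  have hδ1 : δ ≤ (R - R') / 2 := min_le_left _ _
  have hδ2 : δ * ρ ≤ ρ * R - gallagerE0 P ρ - z := (le_div_iff₀ hρ).1 (min_le_right _ _)
  have hsp : spherePacking P (R - (R - R' - δ)) ≤ ((gallagerE0 P ρ - ρ * R' : ℝ) : EReal) := by
    rw [hR'.2]; exact spherePacking_antitone P (by linarith)
  refine le_trans (EReal.coe_le_coe_iff.2 ?_)
    (coe_le_momentBound (ρ := ρ) ⟨by linarith, by linarith⟩ hsp)
  linarith

end MomentBound

/-! ### Lower bounds on the moment exponent. -/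

section Main

lemma div_mem_stdSimplex {X : Type*} [Fintype X] {n : ℕ} (hn : 0 < n) {c : X → ℕ} (hc : ∑ a, c a = n) :
    (fun a => (c a : ℝ) / n) ∈ stdSimplex ℝ X := by
  have hn' : (n : ℝ) ≠ 0 := by exact_mod_cast hn.ne'
  refine ⟨fun a => by positivity, ?_⟩
  rw [← Finset.sum_div, ← Nat.cast_sum, hc, div_self hn']

variable {X Y : Type*} [Fintype X] [Fintype Y] [DecidableEq X] [DecidableEq Y] {P : X → Y → ℝ}

variable [Nonempty X]

/-- The value `l = 0`, outside the range of the supremum, is allowed: it yields `-E_sp(R)` without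
finiteness at any lower rate. -/
lemma sub_spherePacking_le_momentExponent (hP : ∀ x y, 0 ≤ P x y) (hP1 : ∀ x, ∑ y, P x y = 1)
    {ρ R l : ℝ} (hρ : 0 < ρ) (hR : 0 < R) (hl : 0 ≤ l) {s : Score X Y}
    (hs : s = mmiScore ∨ s = mlScore P) {c : ℕ → X → ℕ} (hc : ∀ n, ∑ a, c n a = n) :
    ((ρ * l : ℝ) : EReal) - spherePacking P (R - l) ≤ momentExponent P s c R ρ := by
  by_cases hfin : spherePacking P (R - l) = ⊤
  · rw [hfin, EReal.sub_top]; exact bot_le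
  obtain ⟨E, hE0, hE⟩ := exists_coe_eq_spherePacking hP hP1 hfin
  rw [hE, ← EReal.coe_sub]
  refine le_momentExponent hP hρ hR hs hc fun ε hε => ?_
  filter_upwards [eventually_gt_atTop 0] with n hn
  have hδ : 0 < ε / (2 + ρ) := by positivity
  obtain ⟨w, hw, hD, hI⟩ := exists_joint_of_spherePacking_le hP hP1 hE.le
    (div_mem_stdSimplex hn (hc n)) hδ
  refine ⟨w, hw, ?_⟩
  have e : ε / (2 + ρ) * (2 + ρ) = ε := by field_simp
  have h1 : -(ε / (2 + ρ)) ≤ min 0 (R - mutInfo w) := le_min (by linarith) (by linarith)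
  have h2 : ρ * (l - ε / (2 + ρ)) ≤ ρ * max 0 (R - mutInfo w) :=
    mul_le_mul_of_nonneg_left (le_max_of_le_right (by linarith)) hρ.le
  linarith

lemma neg_spherePacking_le_momentExponent (hP : ∀ x y, 0 ≤ P x y) (hP1 : ∀ x, ∑ y, P x y = 1)
    {ρ R : ℝ} (hρ : 0 < ρ) (hR : 0 < R) {s : Score X Y}
    (hs : s = mmiScore ∨ s = mlScore P) {c : ℕ → X → ℕ} (hc : ∀ n, ∑ a, c n a = n) :
    -spherePacking P R ≤ momentExponent P s c R ρ := by
  have := sub_spherePacking_le_momentExponent hP hP1 hρ hR le_rfl hs hc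
  simpa using this

lemma sub_gallagerE0_le_momentExponent (hP : ∀ x y, 0 ≤ P x y) (hP1 : ∀ x, ∑ y, P x y = 1)
    {ρ R r : ℝ} (hρ : 0 < ρ) (hR : 0 < R) {s : Score X Y}
    (hs : s = mmiScore ∨ s = mlScore P) {c : ℕ → X → ℕ} (hc : ∀ n, ∑ a, c n a = n) {Q : X → ℝ}
    (hr : IsAchieverPair P R r Q) (hrρ : r < ρ)
    (hlim : ∀ a, Tendsto (fun n : ℕ => (c n a : ℝ) / n) atTop (𝓝 (Q a))) :
    ((ρ * R - gallagerE0 P ρ : ℝ) : EReal) ≤ momentExponent P s c R ρ := by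
  obtain ⟨hr0, hQ, hach⟩ := hr
  obtain ⟨V, hV0, hV1, hVP, hV⟩ := exists_testChannel hP hP1 hρ.le
  have hj : ∀ Q ∈ stdSimplex ℝ X, IsJoint P Q fun x y => Q x * V x y := fun Q hQ =>
    ⟨fun x y => mul_nonneg (hQ.1 x) (hV0 x y), fun x => by rw [← Finset.mul_sum, hV1, mul_one],
      fun x y h => by rw [hVP x y h, mul_zero]⟩
  -- If `I ≤ R` at the limit, continuity makes the `min` term negligible along `Q_n`. If `I > R`,
  -- then `E_sp(R) ≤ D + r (I - R) ≤ D + ρ (I - R) ≤ E₀(ρ) - ρR`, and the bound `-E_sp(R)` suffices.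
  rcases le_or_gt (mutInfo fun x y => Q x * V x y) R with hI | hI
  · refine le_momentExponent hP hρ hR hs hc fun ε hε => ?_
    have ht : Tendsto (fun n : ℕ => mutInfo fun x y => (c n x : ℝ) / n * V x y) atTop
        (𝓝 (mutInfo fun x y => Q x * V x y)) := by
      refine (continuous_mutInfo.tendsto _).comp ?_
      exact tendsto_pi_nhds.2 fun x => tendsto_pi_nhds.2 fun y => (hlim x).mul_const _
    filter_upwards [eventually_gt_atTop 0, ht.eventually_lt_const (lt_of_le_of_lt hI
      (lt_add_of_pos_right R hε))] with n hn hlt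
    have hQn := div_mem_stdSimplex hn (hc n)
    refine ⟨_, hj _ hQn, ?_⟩
    have h1 := hV _ hQn
    set I := mutInfo fun x y => (c n x : ℝ) / n * V x y
    have h2 : -ε ≤ min 0 (R - I) := le_min (by linarith) (by linarith)
    have h3 : ρ * (R - I) ≤ ρ * max 0 (R - I) :=
      mul_le_mul_of_nonneg_left (le_max_right _ _) hρ.le
    linarith
  · refine le_trans ?_ (neg_spherePacking_le_momentExponent hP hP1 hρ hR hs hc)
    rw [← hach, ← EReal.coe_neg]
    refine EReal.coe_le_coe_iff.2 ?_
    have h1 := hV Q hQ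
    have h2 := (hj Q hQ).gallagerE0Q_le hP hQ hr0
    have h3 := mul_le_mul_of_nonneg_left hI.le (sub_nonneg.2 hrρ.le)
    linarith

end Main

end ListDecoding

end

theorem mainTheorem6 {X Y : Type*} [Fintype X] [Fintype Y] [DecidableEq X] [DecidableEq Y]
    [Nonempty X] (P : X → Y → ℝ) (hP_nonneg : ∀ x y, 0 ≤ P x y) (hP_sum : ∀ x, ∑ y, P x y = 1)
    (R : ℝ) (hR : 0 < R) (ρ : ℝ) (hρ : 0 < ρ) :
    -- the moment bound, for every sequence of types and for both scores
    (∀ s : ListDecoding.Score X Y, s = ListDecoding.mmiScore ∨ s = ListDecoding.mlScore P →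
      ∀ c : ℕ → X → ℕ, (∀ n, ∑ a, c n a = n) →
        ListDecoding.momentBound P R ρ ≤ ListDecoding.momentExponent P s c R ρ) ∧
    -- the evaluation of the supremum
    ((∃ r < R, ListDecoding.spherePacking P r ≠ ⊤) →
      (∃ r, ListDecoding.IsAchiever P R r) ∧
      ∀ r, ListDecoding.IsAchiever P R r →
        (ρ ≤ r → ListDecoding.momentBound P R ρ = -ListDecoding.spherePacking P R) ∧
        (r < ρ → (∃ R', ListDecoding.IsAchiever P R' ρ) →
          ListDecoding.momentBound P R ρ =
            ((ρ * R - ListDecoding.gallagerE0 P ρ : ℝ) : EReal))) ∧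
    -- the moment bound in its two-line form
    (∀ s : ListDecoding.Score X Y, s = ListDecoding.mmiScore ∨ s = ListDecoding.mlScore P →
      ∀ c : ℕ → X → ℕ, (∀ n, ∑ a, c n a = n) →
        (∀ r, ListDecoding.IsAchiever P R r → ρ ≤ r →
          -ListDecoding.spherePacking P R ≤ ListDecoding.momentExponent P s c R ρ) ∧
        (∀ r Q, ListDecoding.IsAchieverPair P R r Q → r < ρ →
          (∀ a, Tendsto (fun n : ℕ => (c n a : ℝ) / n) atTop (𝓝 (Q a))) →
            ((ρ * R - ListDecoding.gallagerE0 P ρ : ℝ) : EReal) ≤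
              ListDecoding.momentExponent P s c R ρ)) := by
  refine ⟨fun s hs c hc => iSup_le fun l =>
      ListDecoding.sub_spherePacking_le_momentExponent hP_nonneg hP_sum hρ hR l.2.1.le hs hc,
    ?_, fun s hs c hc => ⟨fun _ _ _ =>
      ListDecoding.neg_spherePacking_le_momentExponent hP_nonneg hP_sum hρ hR hs hc,
      fun _ _ hr hrρ hlim => ListDecoding.sub_gallagerE0_le_momentExponent hP_nonneg hP_sum hρ hR
        hs hc hr hrρ hlim⟩⟩
  rintro ⟨r₀, hr₀, hfin⟩
  refine ⟨ListDecoding.exists_isAchiever hP_nonneg hP_sum hr₀ hfin, fun r hr => ⟨fun hρr => ?_, ?_⟩⟩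
  · exact ListDecoding.momentBound_eq_neg_spherePacking hP_nonneg hP_sum hR hρ hr₀ hfin hr hρr
  · rintro hrρ ⟨R', hR'⟩
    exact ListDecoding.momentBound_eq_sub_gallagerE0 hP_nonneg hP_sum hR hρ hr₀ hfin hr hrρ hR'
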